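/- \textbf{Setting.} Let $F:\mathbb R^d\to\mathbb R^d$ satisfy $F(x^*)=0$ and $\|F(x)-F(y)\|\le C\|x-y\|$ for all $x,y$ (Euclidean norm, $C>0$). Let $V:\mathbb R^d\to\mathbb R$ be locally Lipschitz, and let $\partial V(x)$ be its Clarke generalized gradient, i.e. the closed convex hull of all limits $\lim_i\nabla V(y_i)$ with $y_i\to x$ and $V$ differentiable at each $y_i$. Assume that there are constants $a,\gamma,G,C_1,C_2>0$ such that for all $x\in\mathbb R^d$ and all $g\in\partial V(x)$ $$\langle g,F(x)\rangle\le-\gamma V(x),\qquad C_1\|x-x^*\|^a\le V(x)\le C_2\|x-x^*\|^a,\qquad \|g\|\le G\|x-x^*\|^{a-1}.$$ Let $\alpha>0$, $\xi\in[0,1]$, $K\ge1$, $\alpha_k=\alpha/(k+K)^{\xi}$, and let $$x_{k+1}=x_k+\alpha_k\,(F(x_k)+w_k),\qquad k\ge0,$$ where $x_0$ and all $w_k$ are square-integrable random vectors and, with $\mathcal F_k=\sigma(x_0,w_0,\dots,x_{k-1},w_{k-1},x_k)$ and constants $A,B\ge0$, almost surely $$\mathbb E[w_k\mid\mathcal F_k]=0,\qquad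 \mathbb E[\|w_k\|^2\mid\mathcal F_k]\le A+B\|x_k\|^2\qquad(k\ge0).$$ For $\mu>0$ let $M_\mu(x)=\min_u\{V(u)^{2/a}+\|x-u\|^2/(2\mu)\}$ be the Moreau envelope of $V^{2/a}$, and put $$G_M=\tfrac2a\,G\,\max\{C_1^{2/a-1},C_2^{2/a-1}\},\qquad \gamma_M=\Big[\frac{2\gamma C_1^{2/a}}{a(1+\mu G_M)^2}-\mu C G_M^2\Big]C_2^{-2/a},$$ $$c=\frac1{C_1^{2/a}}+2\mu,\qquad D=\frac{A+2B\|x^*\|^2}{\mu},\qquad \bar\alpha=\frac{\gamma_M\,\mu}{2(C^2+2B)\,c}.$$ \textbf{Theorem.} For all sufficiently small $\mu>0$ one has $0<\gamma_M<\frac{2\gamma}{a}(C_1/C_2)^{2/a}$. For every $\mu>0$ with $\gamma_M>0$, the number $\gamma_M$ is a drift constant of $M_\mu$, that is, $\langle g,F(x)\rangle\le-\gamma_M M_\mu(x)$ for all $x\in\mathbb R^d$ and all $g$ in the Clarke generalized gradient of $M_\mu$ at $x$ (in particular for $g=\nabla M_\mu(x)$ wherever $M_\mu$ is differentiable). Moreover,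 for every such $\mu$ and every $k\ge0$, $\|x_k-x^*\|^2$ is integrable, and with $E_0=\mathbb E\|x_0-x^*\|^2$ (equal to $\|x_0-x^*\|^2$ if $x_0$ is deterministic) the following hold. (i) If $\xi=1$ and $K\ge\max\{1,\alpha/\bar\alpha\}$, then $$\mathbb E\|x_k-x^*\|^2\le C_2^{2/a}\,c\,E_0\Big(\frac K{k+K}\Big)^{\alpha\gamma_M/2}+c\,D\cdot\begin{cases}\dfrac{8\alpha^2}{2-\alpha\gamma_M}\dfrac1{(k+K)^{\alpha\gamma_M/2}},&0<\alpha<2/\gamma_M,\\[2mm]\dfrac{4\alpha^2\log(k+K)}{k+K},&\alpha=2/\gamma_M,\\[2mm]\dfrac{8e\alpha^2}{\alpha\gamma_M-2}\dfrac1{k+K},&\alpha>2/\gamma_M.\end{cases}$$ (ii) If $0<\xi<1$ and $K\ge\max\{1,(\alpha/\bar\alpha)^{1/\xi},(4\xi/(\alpha\gamma_M))^{1/(1-\xi)}\}$, then $$\mathbb E\|x_k-x^*\|^2\le C_2^{2/a}\,c\,E_0\exp\Big[-\frac{\alpha\gamma_M}{2(1-\xi)}\big((k+K)^{1-\xi}-K^{1-\xi}\big)\Big]+\frac{4\alpha\,c\,D}{\gamma_M(k+K)^{\xi}}.$$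 (iii) If $\xi=0$ and $\alpha\le\bar\alpha$, then $$\mathbb E\|x_k-x^*\|^2\le C_2^{2/a}\,c\,E_0\Big(1-\frac{\alpha\gamma_M}2\Big)^k+\frac{2\alpha\,c\,D}{\gamma_M}.$$ In particular the second term is $O(1/k)$ for $\xi=1$ and $\alpha>2/\gamma_M$, $O(1/k^\xi)$ for $0<\xi<1$, and for $\xi=0$ the iterates converge exponentially fast in mean square to a ball. -/

import Mathlib

open Set Filter Topology MeasureTheory ProbabilityTheory

noncomputable section

/-- Clarke's generalized gradient of `V` at `x`: the closed convex hull of all limits of gradients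
`∇ V (y i)` along sequences `y i → x` of points at which `V` is differentiable. -/
def clarkeGradient {d : ℕ} (V : EuclideanSpace ℝ (Fin d) → ℝ) (x : EuclideanSpace ℝ (Fin d)) :
    Set (EuclideanSpace ℝ (Fin d)) :=
  closure (convexHull ℝ {g | ∃ y : ℕ → EuclideanSpace ℝ (Fin d),
    (∀ i, DifferentiableAt ℝ V (y i)) ∧ Tendsto y atTop (𝓝 x) ∧
      Tendsto (fun i => gradient V (y i)) atTop (𝓝 g)})

/-- The Moreau envelope `x ↦ inf_u (R u + ‖x - u‖² / (2 μ))`. -/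
def moreauEnvelope {d : ℕ} (R : EuclideanSpace ℝ (Fin d) → ℝ) (μ : ℝ)
    (x : EuclideanSpace ℝ (Fin d)) : ℝ :=
  ⨅ u : EuclideanSpace ℝ (Fin d), (R u + ‖x - u‖ ^ 2 / (2 * μ))

/-- The history `σ(x₀, w₀, …, x_{k-1}, w_{k-1}, x_k)` of the iterates and the noise. -/
@[reducible] def history {Ω : Type*} {d : ℕ} (x w : ℕ → Ω → EuclideanSpace ℝ (Fin d)) (k : ℕ) :
    MeasurableSpace Ω :=
  (⨆ i ∈ Set.Iic k, MeasurableSpace.comap (x i) inferInstance) ⊔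
    (⨆ i ∈ Set.Iio k, MeasurableSpace.comap (w i) inferInstance)

/-- The linear growth constant `G_M` of the generalized gradient of `V ^ (2 / a)`.
The maximum is `C₂ ^ (2 / a - 1)` for `a ≤ 2` and `C₁ ^ (2 / a - 1)` for `a ≥ 2`
(when `C₁ ≤ C₂`). -/
def gradientConst (a G C₁ C₂ : ℝ) : ℝ :=
  2 / a * G * max (C₁ ^ (2 / a - 1)) (C₂ ^ (2 / a - 1))

/-- The drift constant `γ_M` of the Moreau envelope of `V ^ (2 / a)` with parameter `μ`. -/
def driftConst (a γ C G C₁ C₂ μ : ℝ) : ℝ :=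
  (2 * γ * C₁ ^ (2 / a) / (a * (1 + μ * gradientConst a G C₁ C₂) ^ 2)
    - μ * C * gradientConst a G C₁ C₂ ^ 2) * C₂ ^ (-(2 / a))

/-- The factor `1 / C₁ ^ (2 / a) + 2 μ` by which the squared distance to the equilibrium is
compared with the Moreau envelope. -/
def envelopeConst (a C₁ μ : ℝ) : ℝ := 1 / C₁ ^ (2 / a) + 2 * μ

/-- The largest admissible step size: for steps `≤ maxStep` the second order term of the one step
recursion is at most half of the drift term. -/
def maxStep (a γ C G C₁ C₂ B μ : ℝ) : ℝ :=
  driftConst a γ C G C₁ C₂ μ * μ / (2 * (C ^ 2 + 2 * B) * envelopeConst a C₁ μ)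

end

/-!
The Moreau envelope `M` of `V ^ (2 / a)` is comparable with `‖· - xs‖ ^ 2` and semiconcave: at a
point `x` with proximal point `u` it lies below a parabola of curvature `1 / μ` with slope
`(x - u) / μ` at `x`. By optimality, `(x - u) / μ` is a subgradient of `V ^ (2 / a)` at `u`, hence a
positive multiple of it is a Clarke gradient of `V`, so the drift inequality for `V` at `u` carries
over to `M` at `x` up to the error `F x - F u`, which is of order `μ`. Along the iterates the
parabola needs no smoothness of `V` and gives a linear recursion for `𝔼 M(x_k)`, which is compared
with explicit supersolutions in the three step size regimes.
-/

section MeanValue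

variable {E : Type*} [NormedAddCommGroup E] [NormedSpace ℝ E] {f : E → ℝ} {U : Set E} {L : NNReal}

theorem sub_le_of_ae_lineDeriv_le {z v : E} {s : ℝ} (hf : LipschitzOnWith L f U)
    (hU : ∀ τ ∈ Icc (0 : ℝ) 1, z + τ • v ∈ U)
    (hd : ∀ᵐ τ : ℝ, z + τ • v ∈ U → DifferentiableAt ℝ f (z + τ • v))
    (hs : ∀ y ∈ U, DifferentiableAt ℝ f y → fderiv ℝ f y v ≤ s) :
    f (z + v) - f z ≤ s := by
  have hac : AbsolutelyContinuousOnInterval (fun τ : ℝ => f (z + τ • v)) 0 1 := by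
    refine LipschitzOnWith.absolutelyContinuousOnInterval (K := L * ‖v‖₊) ?_
    rw [uIcc_of_le zero_le_one]
    refine hf.comp (LipschitzWith.lipschitzOnWith ?_) hU
    exact LipschitzWith.of_dist_le_mul fun σ τ => by
      rw [dist_add_left, dist_eq_norm, ← sub_smul, norm_smul, ← dist_eq_norm, mul_comm, coe_nnnorm]
  have hderiv : ∀ᵐ τ ∂volume.restrict (Icc (0 : ℝ) 1),
      deriv (fun τ : ℝ => f (z + τ • v)) τ ≤ s := by
    rw [ae_restrict_iff' measurableSet_Icc]
    filter_upwards [hd] with τ hτ hmem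
    have hdiff := hτ (hU τ hmem)
    have hline : HasDerivAt (fun τ : ℝ => z + τ • v) v τ := by
      simpa using ((hasDerivAt_id τ).smul_const v).const_add z
    exact (hdiff.hasFDerivAt.comp_hasDerivAt τ hline).deriv.trans_le (hs _ (hU τ hmem) hdiff)
  calc f (z + v) - f z = ∫ τ in (0 : ℝ)..1, deriv (fun τ : ℝ => f (z + τ • v)) τ := by
        simp [hac.integral_deriv_eq_sub]
    _ ≤ ∫ _ in (0 : ℝ)..1, s :=
        intervalIntegral.integral_mono_ae_restrict zero_le_one hac.intervalIntegrable_deriv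
          intervalIntegrable_const hderiv
    _ = s := by simp

/-- By Rademacher's theorem and Fubini, almost every line parallel to `y - x` meets the
differentiability points of `f` in a set of full length. -/
theorem sub_le_of_fderiv_le_of_lipschitzOnWith [FiniteDimensional ℝ E] (hUo : IsOpen U)
    (hUc : Convex ℝ U) (hf : LipschitzOnWith L f U) {x y : E} (hx : x ∈ U) (hy : y ∈ U) {s : ℝ}
    (hs : ∀ z ∈ U, DifferentiableAt ℝ f z → fderiv ℝ f z (y - x) ≤ s) : f y - f x ≤ s := by
  borelize E
  let ν : Measure E := Measure.addHaar
  let S : Set E := {z | z ∈ U → DifferentiableAt ℝ f z}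
  have hS : MeasurableSet S := by
    have : S = Uᶜ ∪ {z | DifferentiableAt ℝ f z} := by ext z; simp [S, imp_iff_not_or]
    exact this ▸ hUo.measurableSet.compl.union (measurableSet_of_differentiableAt ℝ f)
  have hSae : ∀ᵐ z ∂ν, z ∈ S := by
    filter_upwards [hf.ae_differentiableWithinAt_of_mem (μ := ν)] with z hz hzU
    exact (hz hzU).differentiableAt (hUo.mem_nhds hzU)
  have hlines : ∀ᵐ z ∂ν, ∀ᵐ τ : ℝ, z + τ • (y - x) ∈ S :=
    (ae_ae_add_linearMap_mem_iff (LinearMap.toSpanSingleton ℝ E (y - x)) volume ν hS).2 hSae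
  have hcont : Tendsto (fun z => f (z + (y - x)) - f z) (𝓝 x) (𝓝 (f y - f x)) := by
    refine Tendsto.sub ?_ (hf.continuousOn.continuousAt (hUo.mem_nhds hx)).tendsto
    refine (hf.continuousOn.continuousAt (hUo.mem_nhds hy)).tendsto.comp ?_
    exact Continuous.tendsto' (by fun_prop) _ _ (by abel)
  have hnear : ∀ᶠ z in 𝓝 x, z ∈ U ∧ z + (y - x) ∈ U :=
    (hUo.eventually_mem hx).and <| (Continuous.tendsto' (by fun_prop) x y (by abel)).eventually
      (hUo.eventually_mem hy)
  have hfreq : ∃ᶠ z in 𝓝 x, ∀ᵐ τ : ℝ, z + τ • (y - x) ∈ S :=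
    mem_closure_iff_frequently.1 (Measure.dense_of_ae hlines x)
  refine le_of_tendsto_of_frequently hcont ((hfreq.and_eventually hnear).mono ?_)
  rintro z ⟨hz, hzU, hzyU⟩
  refine sub_le_of_ae_lineDeriv_le hf (fun τ hτ => ?_) hz hs
  simpa using hUc.add_smul_mem hzU hzyU hτ

end MeanValue

section ClarkeGradient

variable {d : ℕ} {V : EuclideanSpace ℝ (Fin d) → ℝ} {u v p : EuclideanSpace ℝ (Fin d)} {s : ℝ}

theorem eventually_fderiv_le_of_forall_mem_clarkeGradient (hV : LocallyLipschitz V)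
    (h : ∀ g ∈ clarkeGradient V u, inner ℝ g v < s) :
    ∀ᶠ y in 𝓝 u, DifferentiableAt ℝ V y → fderiv ℝ V y v ≤ s := by
  by_contra hcon
  obtain ⟨L, T, hT, hLT⟩ := hV u
  have hfreq : ∃ᶠ y in 𝓝 u, (DifferentiableAt ℝ V y ∧ s < fderiv ℝ V y v) ∧ T ∈ 𝓝 y := by
    refine Frequently.and_eventually ?_ (eventually_mem_nhds_iff.2 hT)
    simpa [not_eventually] using hcon
  obtain ⟨y, hy, hprop⟩ := exists_seq_forall_of_frequently hfreq
  have hbounded : ∀ n, gradient V (y n) ∈ Metric.closedBall 0 (L : ℝ) := fun n => by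
    rw [mem_closedBall_zero_iff, gradient, LinearIsometryEquiv.norm_map]
    exact norm_fderiv_le_of_lipschitzOn ℝ (hprop n).2 hLT
  obtain ⟨g, -, φ, hφ, hg⟩ := (isCompact_closedBall _ _).tendsto_subseq hbounded
  have hgmem : g ∈ clarkeGradient V u := subset_closure <| subset_convexHull ℝ _
    ⟨y ∘ φ, fun i => (hprop _).1.1, hy.comp hφ.tendsto_atTop, hg⟩
  refine (h g hgmem).not_ge (ge_of_tendsto (hg.inner tendsto_const_nhds) ?_)
  refine Eventually.of_forall fun n => ?_
  rw [Function.comp_apply, inner_gradient_left]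
  exact (hprop _).1.2.le

theorem eventually_sub_le_of_forall_mem_clarkeGradient (hV : LocallyLipschitz V)
    (h : ∀ g ∈ clarkeGradient V u, inner ℝ g v < s) :
    ∀ᶠ t : ℝ in 𝓝[>] 0, V (u + t • v) - V u ≤ t * s := by
  obtain ⟨L, T, hT, hLT⟩ := hV u
  obtain ⟨r, hr, hball⟩ := Metric.eventually_nhds_iff_ball.1
    ((eventually_fderiv_le_of_forall_mem_clarkeGradient hV h).and hT)
  have hline : Tendsto (fun t : ℝ => u + t • v) (𝓝[>] 0) (𝓝 u) :=
    (Continuous.tendsto' (by fun_prop) _ _ (by simp)).mono_left nhdsWithin_le_nhds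
  filter_upwards [hline (Metric.ball_mem_nhds u hr), self_mem_nhdsWithin] with t ht htpos
  refine sub_le_of_fderiv_le_of_lipschitzOnWith Metric.isOpen_ball (convex_ball u r)
    (hLT.mono fun y hy => (hball y hy).2) (Metric.mem_ball_self hr) ht fun y hy hd => ?_
  rw [add_sub_cancel_left, map_smul, smul_eq_mul]
  exact mul_le_mul_of_nonneg_left ((hball y hy).1 hd) (le_of_lt htpos)

theorem mem_clarkeGradient_of_hasGradientAt_of_le {Q : EuclideanSpace ℝ (Fin d) → ℝ}
    (hV : LocallyLipschitz V) (hQ : HasGradientAt Q p u) (hQu : Q u = V u)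
    (hQV : ∀ᶠ z in 𝓝 u, Q z ≤ V z) : p ∈ clarkeGradient V u := by
  by_contra hp
  obtain ⟨f, s, hfs, hsp⟩ := geometric_hahn_banach_closed_point
    (convex_convexHull ℝ _).closure isClosed_closure hp
  let v := (InnerProductSpace.toDual ℝ (EuclideanSpace ℝ (Fin d))).symm f
  have hf : ∀ y, f y = inner ℝ y v := fun y => by rw [real_inner_comm]; simp [v]
  have hline : HasDerivAt (fun t : ℝ => u + t • v) v 0 := by
    simpa using ((hasDerivAt_id (0 : ℝ)).smul_const v).const_add u
  have hslope : Tendsto (fun t : ℝ => t⁻¹ • (Q (u + t • v) - Q u)) (𝓝[>] 0) (𝓝 (f p)) := by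
    have hderiv := hQ.hasFDerivAt.comp_hasDerivAt_of_eq (0 : ℝ) hline (by simp)
    simpa [hf] using hderiv.tendsto_slope_zero_right
  have htouch : ∀ᶠ t : ℝ in 𝓝[>] 0, Q (u + t • v) ≤ V (u + t • v) :=
    nhdsWithin_le_nhds <| (Continuous.tendsto' (by fun_prop) _ _ (by simp)).eventually hQV
  refine hsp.not_ge (le_of_tendsto hslope ?_)
  filter_upwards [htouch, self_mem_nhdsWithin, eventually_sub_le_of_forall_mem_clarkeGradient hV
    fun g hg => hf g ▸ hfs g hg] with t hle ht hinc
  rw [smul_eq_mul, inv_mul_le_iff₀ ht, hQu]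
  linarith

/-- The function `Q ^ r⁻¹` touches `V` from below at `u`. -/
theorem smul_mem_clarkeGradient_of_hasGradientAt_of_le_rpow
    {Q : EuclideanSpace ℝ (Fin d) → ℝ} {r : ℝ} (hr : 0 < r) (hV : LocallyLipschitz V)
    (hVu : 0 < V u) (hQ : HasGradientAt Q p u) (hQu : Q u = V u ^ r)
    (hQV : ∀ᶠ z in 𝓝 u, Q z ≤ V z ^ r) : (r⁻¹ * V u ^ (1 - r)) • p ∈ clarkeGradient V u := by
  have hQpos : 0 < Q u := hQu ▸ Real.rpow_pos_of_pos hVu r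
  refine mem_clarkeGradient_of_hasGradientAt_of_le (Q := fun z => Q z ^ r⁻¹) hV ?_ ?_ ?_
  · refine (hQ.hasFDerivAt.rpow_const (p := r⁻¹) (Or.inl hQpos.ne')).congr_fderiv ?_
    have hexp : Q u ^ (r⁻¹ - 1) = V u ^ (1 - r) := by
      rw [hQu, ← Real.rpow_mul hVu.le, mul_sub, mul_inv_cancel₀ hr.ne', mul_one]
    rw [hexp, map_smul]
  · simp only [hQu, Real.rpow_rpow_inv hVu.le hr.ne']
  · filter_upwards [hQV, hQ.continuousAt.eventually (lt_mem_nhds hQpos),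
      hV.continuous.continuousAt.eventually (lt_mem_nhds hVu)] with z hle hQz hVz
    calc Q z ^ r⁻¹ ≤ (V z ^ r) ^ r⁻¹ := by gcongr
      _ = V z := Real.rpow_rpow_inv hVz.le hr.ne'

end ClarkeGradient

section MoreauEnvelope

theorem hasGradientAt_norm_sub_sq_div {E : Type*} [NormedAddCommGroup E] [InnerProductSpace ℝ E]
    [CompleteSpace E] (u x : E) (μ : ℝ) :
    HasGradientAt (fun z => ‖z - u‖ ^ 2 / (2 * μ)) (μ⁻¹ • (x - u)) x := by
  simp only [div_eq_mul_inv]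
  refine ((((hasFDerivAt_id x).sub_const u).norm_sq).mul_const (2 * μ)⁻¹).congr_fderiv ?_
  ext v
  simp
  ring

theorem hasGradientAt_zero_of_le_sq {E : Type*} [NormedAddCommGroup E] [InnerProductSpace ℝ E]
    [CompleteSpace E] {f : E → ℝ} {x₀ : E} {c : ℝ} (hf : ∀ x, 0 ≤ f x)
    (hle : ∀ x, f x ≤ c * ‖x - x₀‖ ^ 2) : HasGradientAt f 0 x₀ := by
  have hf₀ : f x₀ = 0 := le_antisymm (by simpa using hle x₀) (hf x₀)
  rw [hasGradientAt_iff_isLittleO]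
  simp only [hf₀, inner_zero_left, sub_zero]
  refine Asymptotics.IsBigO.trans_isLittleO (.of_bound c (.of_forall fun x => ?_))
    (Asymptotics.isLittleO_pow_sub_sub x₀ one_lt_two)
  simpa [abs_of_nonneg (hf x)] using hle x

variable {d : ℕ} {R : EuclideanSpace ℝ (Fin d) → ℝ} {μ : ℝ} {x u : EuclideanSpace ℝ (Fin d)}

/-- `u` is a proximal point of `x`: it attains the infimum that defines the Moreau envelope of `R`
at `x`. -/
def IsProximalPoint (R : EuclideanSpace ℝ (Fin d) → ℝ) (μ : ℝ) (x u : EuclideanSpace ℝ (Fin d)) :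
    Prop :=
  moreauEnvelope R μ x = R u + ‖x - u‖ ^ 2 / (2 * μ)

theorem moreauEnvelope_nonneg (hR : ∀ z, 0 ≤ R z) (hμ : 0 < μ) (x : EuclideanSpace ℝ (Fin d)) :
    0 ≤ moreauEnvelope R μ x :=
  le_ciInf fun u => add_nonneg (hR u) (by positivity)

theorem moreauEnvelope_le (hR : ∀ z, 0 ≤ R z) (hμ : 0 < μ) (x u : EuclideanSpace ℝ (Fin d)) :
    moreauEnvelope R μ x ≤ R u + ‖x - u‖ ^ 2 / (2 * μ) :=
  ciInf_le ⟨0, forall_mem_range.2 fun z => add_nonneg (hR z) (by positivity)⟩ u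

theorem moreauEnvelope_le_self (hR : ∀ z, 0 ≤ R z) (hμ : 0 < μ) (x : EuclideanSpace ℝ (Fin d)) :
    moreauEnvelope R μ x ≤ R x := by
  simpa using moreauEnvelope_le hR hμ x x

theorem exists_isProximalPoint (hR : ∀ z, 0 ≤ R z) (hRc : Continuous R) (hμ : 0 < μ)
    (x : EuclideanSpace ℝ (Fin d)) : ∃ u, IsProximalPoint R μ x u := by
  have hcoercive : Tendsto (fun u => R u + ‖x - u‖ ^ 2 / (2 * μ)) (cocompact _) atTop := by
    refine tendsto_atTop_mono (fun u => le_add_of_nonneg_left (hR u)) ?_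
    refine Tendsto.atTop_div_const (by positivity) ((tendsto_pow_atTop two_ne_zero).comp ?_)
    exact (tendsto_norm_cocompact_atTop (E := EuclideanSpace ℝ (Fin d))).comp
      (Homeomorph.subLeft x).isClosedEmbedding.tendsto_cocompact
  obtain ⟨u, hu⟩ := Continuous.exists_forall_le (by fun_prop) hcoercive
  exact ⟨u, le_antisymm (moreauEnvelope_le hR hμ x u) (le_ciInf hu)⟩

theorem IsProximalPoint.moreauEnvelope_le_add (hR : ∀ z, 0 ≤ R z) (hμ : 0 < μ)
    (hu : IsProximalPoint R μ x u) (z : EuclideanSpace ℝ (Fin d)) :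
    moreauEnvelope R μ z ≤
      moreauEnvelope R μ x + inner ℝ (μ⁻¹ • (x - u)) (z - x) + ‖z - x‖ ^ 2 / (2 * μ) := by
  refine (moreauEnvelope_le hR hμ z u).trans_eq ?_
  rw [hu, show z - u = (x - u) + (z - x) by abel, norm_add_sq_real, real_inner_smul_left]
  field_simp
  ring

theorem IsProximalPoint.gradient_moreauEnvelope (hR : ∀ z, 0 ≤ R z) (hμ : 0 < μ)
    (hu : IsProximalPoint R μ x u) (hd : DifferentiableAt ℝ (moreauEnvelope R μ) x) :
    gradient (moreauEnvelope R μ) x = μ⁻¹ • (x - u) := by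
  have hmin : IsLocalMin (fun z => R u + ‖z - u‖ ^ 2 / (2 * μ) - moreauEnvelope R μ z) x := by
    refine .of_forall fun z => ?_
    have hz := moreauEnvelope_le hR hμ z u
    simpa [← hu.symm] using hz
  have hzero := hmin.hasFDerivAt_eq_zero
    (((hasGradientAt_norm_sub_sq_div u x μ).hasFDerivAt.const_add (R u)).sub hd.hasFDerivAt)
  rw [gradient, ← sub_eq_zero.1 hzero, LinearIsometryEquiv.symm_apply_apply]

theorem IsProximalPoint.smul_sub_eq_of_hasGradientAt (hR : ∀ z, 0 ≤ R z) (hμ : 0 < μ)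
    (hu : IsProximalPoint R μ x u) {p : EuclideanSpace ℝ (Fin d)} (hp : HasGradientAt R p u) :
    μ⁻¹ • (x - u) = p := by
  have hmin : IsLocalMin (fun z => R z + ‖z - x‖ ^ 2 / (2 * μ)) u := by
    refine .of_forall fun z => ?_
    simpa only [norm_sub_rev _ x] using hu.symm.trans_le (moreauEnvelope_le hR hμ x z)
  have hzero := hmin.hasFDerivAt_eq_zero
    (hp.hasFDerivAt.add (hasGradientAt_norm_sub_sq_div x u μ).hasFDerivAt)
  rw [← map_add, map_eq_zero_iff _ (LinearIsometryEquiv.injective _)] at hzero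
  rw [eq_neg_of_add_eq_zero_left hzero, ← smul_neg, neg_sub]

theorem concaveOn_moreauEnvelope_sub_norm_sq (hR : ∀ z, 0 ≤ R z) (hRc : Continuous R)
    (hμ : 0 < μ) : ConcaveOn ℝ univ fun x => moreauEnvelope R μ x - ‖x‖ ^ 2 / (2 * μ) := by
  refine ⟨convex_univ, fun x _ y _ s t hs ht hst => ?_⟩
  obtain ⟨u, hu⟩ := exists_isProximalPoint hR hRc hμ (s • x + t • y)
  have haffine : ∀ z, R u + ‖z - u‖ ^ 2 / (2 * μ) - ‖z‖ ^ 2 / (2 * μ)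
      = R u + ‖u‖ ^ 2 / (2 * μ) - inner ℝ z u / μ := fun z => by
    rw [norm_sub_sq_real]
    field_simp
    ring
  have hle : ∀ z, moreauEnvelope R μ z - ‖z‖ ^ 2 / (2 * μ)
      ≤ R u + ‖u‖ ^ 2 / (2 * μ) - inner ℝ z u / μ := fun z =>
    (haffine z).symm ▸ sub_le_sub_right (moreauEnvelope_le hR hμ z u) _
  calc s * (moreauEnvelope R μ x - ‖x‖ ^ 2 / (2 * μ))
        + t * (moreauEnvelope R μ y - ‖y‖ ^ 2 / (2 * μ))
      ≤ s * (R u + ‖u‖ ^ 2 / (2 * μ) - inner ℝ x u / μ)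
        + t * (R u + ‖u‖ ^ 2 / (2 * μ) - inner ℝ y u / μ) :=
        add_le_add (mul_le_mul_of_nonneg_left (hle x) hs) (mul_le_mul_of_nonneg_left (hle y) ht)
    _ = R u + ‖u‖ ^ 2 / (2 * μ) - inner ℝ (s • x + t • y) u / μ := by
        rw [inner_add_left, real_inner_smul_left, real_inner_smul_left, eq_sub_of_add_eq' hst]
        ring
    _ = moreauEnvelope R μ (s • x + t • y) - ‖s • x + t • y‖ ^ 2 / (2 * μ) := by
        rw [hu, haffine]

theorem continuous_moreauEnvelope (hR : ∀ z, 0 ≤ R z) (hRc : Continuous R) (hμ : 0 < μ) :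
    Continuous (moreauEnvelope R μ) := by
  have hsub := (concaveOn_moreauEnvelope_sub_norm_sq hR hRc hμ).locallyLipschitz.continuous
  have hsq : Continuous fun x : EuclideanSpace ℝ (Fin d) => ‖x‖ ^ 2 / (2 * μ) := by fun_prop
  exact (hsub.add hsq).congr fun x => sub_add_cancel _ _

theorem sq_norm_sub_le_mul_moreauEnvelope {c₁ : ℝ} {x₀ : EuclideanSpace ℝ (Fin d)} (hc₁ : 0 < c₁)
    (hR : ∀ z, c₁ * ‖z - x₀‖ ^ 2 ≤ R z) (hμ : 0 < μ) (x : EuclideanSpace ℝ (Fin d)) :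
    ‖x - x₀‖ ^ 2 ≤ (1 / c₁ + 2 * μ) * moreauEnvelope R μ x := by
  rw [← div_le_iff₀' (by positivity)]
  refine le_ciInf fun u => ?_
  rw [div_le_iff₀' (by positivity)]
  calc ‖x - x₀‖ ^ 2 ≤ (‖u - x₀‖ + ‖x - u‖) ^ 2 := by
        gcongr
        simpa [add_comm] using norm_sub_le_norm_sub_add_norm_sub x u x₀
    _ ≤ (1 / c₁ + 2 * μ) * (c₁ * ‖u - x₀‖ ^ 2 + ‖x - u‖ ^ 2 / (2 * μ)) := by
        have hsq : 0 ≤ (2 * μ * c₁ * ‖u - x₀‖ - ‖x - u‖) ^ 2 / (2 * μ * c₁) := by positivity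
        rw [← sub_nonneg]
        refine hsq.trans_eq ?_
        field_simp
        ring
    _ ≤ (1 / c₁ + 2 * μ) * (R u + ‖x - u‖ ^ 2 / (2 * μ)) := by
        gcongr
        exact hR u

end MoreauEnvelope

section Growth

variable {a c v r : ℝ}

theorem mul_rpow_rpow_two_div (ha : 0 < a) (hc : 0 ≤ c) (hr : 0 ≤ r) :
    (c * r ^ a) ^ (2 / a) = c ^ (2 / a) * r ^ 2 := by
  rw [Real.mul_rpow hc (by positivity), ← Real.rpow_mul hr, mul_div_cancel₀ _ ha.ne', Real.rpow_two]

theorem mul_sq_le_rpow_two_div (ha : 0 < a) (hc : 0 ≤ c) (hr : 0 ≤ r) (h : c * r ^ a ≤ v) :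
    c ^ (2 / a) * r ^ 2 ≤ v ^ (2 / a) :=
  mul_rpow_rpow_two_div ha hc hr ▸ Real.rpow_le_rpow (by positivity) h (by positivity)

theorem rpow_two_div_le_mul_sq (ha : 0 < a) (hc : 0 ≤ c) (hr : 0 ≤ r) (hv : 0 ≤ v)
    (h : v ≤ c * r ^ a) : v ^ (2 / a) ≤ c ^ (2 / a) * r ^ 2 :=
  mul_rpow_rpow_two_div ha hc hr ▸ Real.rpow_le_rpow hv h (by positivity)

theorem rpow_le_max_mul_rpow {c₁ c₂ s : ℝ} (hc₁ : 0 < c₁) (hc₂ : 0 ≤ c₂) (hs : 0 < s)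
    (hle : c₁ * s ≤ v) (hge : v ≤ c₂ * s) (p : ℝ) :
    v ^ p ≤ max (c₁ ^ p) (c₂ ^ p) * s ^ p := by
  have hc₁s : 0 < c₁ * s := mul_pos hc₁ hs
  rcases le_total 0 p with hp | hp
  · calc v ^ p ≤ (c₂ * s) ^ p := Real.rpow_le_rpow (hc₁s.le.trans hle) hge hp
      _ = c₂ ^ p * s ^ p := Real.mul_rpow hc₂ hs.le
      _ ≤ max (c₁ ^ p) (c₂ ^ p) * s ^ p := by gcongr; exact le_max_right _ _
  · calc v ^ p ≤ (c₁ * s) ^ p := Real.rpow_le_rpow_of_nonpos hc₁s hle hp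
      _ = c₁ ^ p * s ^ p := Real.mul_rpow hc₁.le hs.le
      _ ≤ max (c₁ ^ p) (c₂ ^ p) * s ^ p := by gcongr; exact le_max_left _ _

theorem gradientConst_pos {a G C₁ C₂ : ℝ} (ha : 0 < a) (hG : 0 < G) (hC₁ : 0 < C₁) :
    0 < gradientConst a G C₁ C₂ :=
  mul_pos (by positivity) (lt_max_of_lt_left (Real.rpow_pos_of_pos hC₁ _))

theorem driftConst_lt {a γ C G C₁ C₂ μ : ℝ} (ha : 0 < a) (hγ : 0 < γ) (hC : 0 < C) (hG : 0 < G)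
    (hC₁ : 0 < C₁) (hC₂ : 0 < C₂) (hμ : 0 < μ) :
    driftConst a γ C G C₁ C₂ μ < 2 * γ / a * (C₁ / C₂) ^ (2 / a) := by
  have hL := gradientConst_pos (C₂ := C₂) ha hG hC₁
  rw [driftConst, Real.div_rpow hC₁.le hC₂.le, ← mul_div_assoc, div_eq_mul_inv _ (C₂ ^ _),
    ← Real.rpow_neg hC₂.le]
  set L := gradientConst a G C₁ C₂
  gcongr
  calc 2 * γ * C₁ ^ (2 / a) / (a * (1 + μ * L) ^ 2) - μ * C * L ^ 2
      < 2 * γ * C₁ ^ (2 / a) / (a * (1 + μ * L) ^ 2) := sub_lt_self _ (by positivity)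
    _ ≤ 2 * γ * C₁ ^ (2 / a) / a := by
        gcongr
        exact le_mul_of_one_le_right ha.le (one_le_pow₀ (by nlinarith))
    _ = 2 * γ / a * C₁ ^ (2 / a) := by ring

theorem exists_forall_driftConst_pos {a γ C G C₁ C₂ : ℝ} (ha : 0 < a) (hγ : 0 < γ) (hC₁ : 0 < C₁)
    (hC₂ : 0 < C₂) : ∃ μ₀ > 0, ∀ μ : ℝ, 0 < μ → μ < μ₀ → 0 < driftConst a γ C G C₁ C₂ μ := by
  have hcont : ContinuousAt (driftConst a γ C G C₁ C₂) 0 := by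
    have hne : a * (1 + 0 * gradientConst a G C₁ C₂) ^ 2 ≠ 0 := by simpa using ha.ne'
    unfold driftConst
    fun_prop (disch := exact hne)
  have hzero : 0 < driftConst a γ C G C₁ C₂ 0 := by
    simp only [driftConst, zero_mul, add_zero, one_pow, mul_one, sub_zero]
    positivity
  obtain ⟨μ₀, hμ₀, hball⟩ := Metric.eventually_nhds_iff.1 (hcont.eventually (lt_mem_nhds hzero))
  refine ⟨μ₀, hμ₀, fun μ hμ hlt => hball ?_⟩
  rwa [Real.dist_0_eq_abs, abs_of_pos hμ]

end Growth

section Drift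

variable {d : ℕ} {F : EuclideanSpace ℝ (Fin d) → EuclideanSpace ℝ (Fin d)}
  {V R : EuclideanSpace ℝ (Fin d) → ℝ} {x xs u : EuclideanSpace ℝ (Fin d)}
  {a γ C G C₁ C₂ μ : ℝ}

/-- `V` is a Lyapunov function with exponent `a` for the flow of `F` with equilibrium `xs`: it has
drift `-γ V`, growth between `C₁ ‖· - xs‖ ^ a` and `C₂ ‖· - xs‖ ^ a`, and generalized gradients of
size at most `G ‖· - xs‖ ^ (a - 1)`. -/
structure IsLyapunovFunction (F : EuclideanSpace ℝ (Fin d) → EuclideanSpace ℝ (Fin d))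
    (xs : EuclideanSpace ℝ (Fin d)) (V : EuclideanSpace ℝ (Fin d) → ℝ) (a γ G C₁ C₂ : ℝ) :
    Prop where
  exponent_pos : 0 < a
  rate_pos : 0 < γ
  gradient_pos : 0 < G
  lower_pos : 0 < C₁
  upper_pos : 0 < C₂
  locallyLipschitz : LocallyLipschitz V
  inner_le : ∀ x, ∀ g ∈ clarkeGradient V x, inner ℝ g (F x) ≤ -γ * V x
  growth : ∀ x, C₁ * ‖x - xs‖ ^ a ≤ V x ∧ V x ≤ C₂ * ‖x - xs‖ ^ a
  norm_le : ∀ x, ∀ g ∈ clarkeGradient V x, ‖g‖ ≤ G * ‖x - xs‖ ^ (a - 1)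

/-- The drift inequality with constant `γ` for the Moreau envelope of `R`, required of the proximal
gradients `μ⁻¹ (x - u)`. These exist at every point and are the gradients of the envelope wherever
it is differentiable. -/
def HasProximalDrift (F : EuclideanSpace ℝ (Fin d) → EuclideanSpace ℝ (Fin d))
    (R : EuclideanSpace ℝ (Fin d) → ℝ) (μ γ : ℝ) : Prop :=
  ∀ x u, IsProximalPoint R μ x u → inner ℝ (μ⁻¹ • (x - u)) (F x) ≤ -γ * moreauEnvelope R μ x

theorem HasProximalDrift.inner_le_of_mem_clarkeGradient (hdrift : HasProximalDrift F R μ γ)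
    (hF : Continuous F) (hR : ∀ z, 0 ≤ R z) (hRc : Continuous R) (hμ : 0 < μ)
    {g : EuclideanSpace ℝ (Fin d)} (hg : g ∈ clarkeGradient (moreauEnvelope R μ) x) :
    inner ℝ g (F x) ≤ -γ * moreauEnvelope R μ x := by
  let H : Set (EuclideanSpace ℝ (Fin d)) := {g | inner ℝ g (F x) ≤ -γ * moreauEnvelope R μ x}
  have hclosed : IsClosed H := isClosed_le (by fun_prop) continuous_const
  have hconvex : Convex ℝ H := by
    refine convex_halfSpace_le ⟨fun _ _ => inner_add_left _ _ _, fun c v => ?_⟩ _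
    rw [real_inner_smul_left, smul_eq_mul]
  refine closure_minimal (convexHull_min ?_ hconvex) hclosed hg
  rintro p ⟨y, hd, hy, hp⟩
  refine le_of_tendsto_of_tendsto (hp.inner ((hF.tendsto x).comp hy))
    ((((continuous_moreauEnvelope hR hRc hμ).tendsto x).comp hy).const_mul (-γ)) ?_
  refine .of_forall fun i => ?_
  obtain ⟨u, hu⟩ := exists_isProximalPoint hR hRc hμ (y i)
  have hle := hdrift (y i) u hu
  rwa [← hu.gradient_moreauEnvelope hR hμ (hd i)] at hle

theorem HasProximalDrift.sq_mul_le (hdrift : HasProximalDrift F R μ γ) (hR : ∀ z, 0 ≤ R z)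
    (hRc : Continuous R) (hμ : 0 < μ) (hγ : 0 ≤ γ) {c₁ : ℝ} (hc₁ : 0 < c₁)
    (hR₁ : ∀ z, c₁ * ‖z - xs‖ ^ 2 ≤ R z) (hx : x ≠ xs) (hF : ‖F x‖ ≤ C * ‖x - xs‖) :
    γ ^ 2 * μ ≤ 2 * C ^ 2 * (1 / c₁ + 2 * μ) := by
  obtain ⟨u, hu⟩ := exists_isProximalPoint hR hRc hμ x
  set M := moreauEnvelope R μ x with hM
  have hdist : ‖x - xs‖ ^ 2 ≤ (1 / c₁ + 2 * μ) * M :=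
    sq_norm_sub_le_mul_moreauEnvelope hc₁ hR₁ hμ x
  have hM₀ : 0 < M := by
    have hpos : 0 < ‖x - xs‖ := norm_sub_pos_iff.2 hx
    exact pos_of_mul_pos_right ((pow_pos hpos 2).trans_le hdist) (by positivity)
  have hprox : ‖x - u‖ ^ 2 ≤ 2 * μ * M := by
    rw [← div_le_iff₀' (by positivity), hM, hu]
    exact le_add_of_nonneg_left (hR u)
  have hrate : γ * M ≤ ‖μ⁻¹ • (x - u)‖ * ‖F x‖ := by
    rw [← neg_le_neg_iff, ← neg_mul γ]
    exact (neg_le_of_abs_le (abs_real_inner_le_norm _ _)).trans (hdrift x u hu)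
  have hsq : (γ ^ 2 * μ) * M ^ 2 ≤ 2 * C ^ 2 * (1 / c₁ + 2 * μ) * M ^ 2 := by
    calc (γ ^ 2 * μ) * M ^ 2 = (γ * M) ^ 2 * μ := by ring
      _ ≤ (‖μ⁻¹ • (x - u)‖ * (C * ‖x - xs‖)) ^ 2 * μ := by
          refine mul_le_mul_of_nonneg_right (pow_le_pow_left₀ (by positivity) ?_ 2) hμ.le
          exact hrate.trans (by gcongr)
      _ = ‖x - u‖ ^ 2 / μ * (C ^ 2 * ‖x - xs‖ ^ 2) := by
          rw [norm_smul, Real.norm_of_nonneg (by positivity)]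
          field_simp
      _ ≤ 2 * μ * M / μ * (C ^ 2 * ((1 / c₁ + 2 * μ) * M)) := by gcongr
      _ = 2 * C ^ 2 * (1 / c₁ + 2 * μ) * M ^ 2 := by field_simp
  exact le_of_mul_le_mul_right hsq (by positivity)

theorem IsProximalPoint.smul_mem_clarkeGradient {r : ℝ} (hr : 0 < r) (hV : LocallyLipschitz V)
    (hV₀ : ∀ z, 0 ≤ V z) (hμ : 0 < μ) (hu : IsProximalPoint (fun z => V z ^ r) μ x u)
    (hVu : 0 < V u) : (r⁻¹ * V u ^ (1 - r)) • μ⁻¹ • (x - u) ∈ clarkeGradient V u := by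
  refine smul_mem_clarkeGradient_of_hasGradientAt_of_le_rpow hr hV hVu
    (Q := fun z => V u ^ r + ‖x - u‖ ^ 2 / (2 * μ) - ‖z - x‖ ^ 2 / (2 * μ)) ?_ ?_ ?_
  · refine ((hasGradientAt_norm_sub_sq_div x u μ).hasFDerivAt.const_sub _).congr_fderiv ?_
    rw [← map_neg, ← smul_neg, neg_sub]
  · simp [norm_sub_rev]
  · refine .of_forall fun z => ?_
    have hle := moreauEnvelope_le (fun z => Real.rpow_nonneg (hV₀ z) r) hμ x z
    rw [hu] at hle
    rwa [sub_le_iff_le_add, norm_sub_rev z]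

theorem continuous_of_norm_sub_le {E : Type*} [SeminormedAddCommGroup E] {f : E → E}
    (hf : ∀ y z, ‖f y - f z‖ ≤ C * ‖y - z‖) : Continuous f :=
  (LipschitzWith.of_dist_le' fun y z => by simpa only [dist_eq_norm] using hf y z).continuous

/-- Since `‖x - x₀‖ ≤ (1 + μ L) ‖u - x₀‖`, the decay at `u` is transported to `x`. -/
theorem inner_le_neg_mul_sq_of_sub_eq_smul {E : Type*} [NormedAddCommGroup E]
    [InnerProductSpace ℝ E] {F : E → E} {x u x₀ g : E} {C L κ μ : ℝ} (hμ : 0 ≤ μ) (hC : 0 ≤ C)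
    (hL : 0 ≤ L) (hxu : x - u = μ • g) (hF : ‖F x - F u‖ ≤ C * ‖x - u‖)
    (hdrift : inner ℝ g (F u) ≤ -(κ * ‖u - x₀‖ ^ 2)) (hg : ‖g‖ ≤ L * ‖u - x₀‖)
    (hb : 0 ≤ κ / (1 + μ * L) ^ 2 - μ * C * L ^ 2) :
    inner ℝ g (F x) ≤ -((κ / (1 + μ * L) ^ 2 - μ * C * L ^ 2) * ‖x - x₀‖ ^ 2) := by
  have hnorm : ‖x - u‖ ≤ μ * (L * ‖u - x₀‖) := by
    rw [hxu, norm_smul, Real.norm_of_nonneg hμ]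
    gcongr
  have hdist : ‖x - x₀‖ ≤ (1 + μ * L) * ‖u - x₀‖ := by
    linarith [norm_sub_le_norm_sub_add_norm_sub x u x₀]
  have hcross : inner ℝ g (F x - F u) ≤ μ * C * L ^ 2 * ‖u - x₀‖ ^ 2 := by
    calc inner ℝ g (F x - F u) ≤ ‖g‖ * ‖F x - F u‖ := real_inner_le_norm _ _
      _ ≤ (L * ‖u - x₀‖) * (C * (μ * (L * ‖u - x₀‖))) := by
          gcongr
          exact hF.trans (by gcongr)
      _ = μ * C * L ^ 2 * ‖u - x₀‖ ^ 2 := by ring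
  have hone : 1 ≤ (1 + μ * L) ^ 2 := one_le_pow₀ (by linarith [mul_nonneg hμ hL])
  have htransport : (κ / (1 + μ * L) ^ 2 - μ * C * L ^ 2) * ‖x - x₀‖ ^ 2
      ≤ (κ - μ * C * L ^ 2) * ‖u - x₀‖ ^ 2 := by
    calc _ ≤ (κ / (1 + μ * L) ^ 2 - μ * C * L ^ 2) * ((1 + μ * L) * ‖u - x₀‖) ^ 2 := by gcongr
      _ = (κ - μ * C * L ^ 2 * (1 + μ * L) ^ 2) * ‖u - x₀‖ ^ 2 := by field_simp
      _ ≤ (κ - μ * C * L ^ 2) * ‖u - x₀‖ ^ 2 := by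
          refine mul_le_mul_of_nonneg_right (sub_le_sub_left ?_ κ) (by positivity)
          exact le_mul_of_one_le_right (by positivity) hone
  calc inner ℝ g (F x) = inner ℝ g (F u) + inner ℝ g (F x - F u) := by
        rw [← inner_add_right, add_sub_cancel]
    _ ≤ -(κ * ‖u - x₀‖ ^ 2) + μ * C * L ^ 2 * ‖u - x₀‖ ^ 2 := add_le_add hdrift hcross
    _ ≤ -((κ / (1 + μ * L) ^ 2 - μ * C * L ^ 2) * ‖x - x₀‖ ^ 2) := by linarith

namespace IsLyapunovFunction

variable (hV : IsLyapunovFunction F xs V a γ G C₁ C₂)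
include hV

theorem nonneg (x : EuclideanSpace ℝ (Fin d)) : 0 ≤ V x :=
  (mul_nonneg hV.lower_pos.le (by positivity)).trans (hV.growth x).1

theorem pos_of_ne (hx : x ≠ xs) : 0 < V x := by
  have hpos : 0 < ‖x - xs‖ := norm_sub_pos_iff.2 hx
  exact (mul_pos hV.lower_pos (by positivity)).trans_le (hV.growth x).1

theorem mul_sq_le_rpow (x : EuclideanSpace ℝ (Fin d)) :
    C₁ ^ (2 / a) * ‖x - xs‖ ^ 2 ≤ V x ^ (2 / a) :=
  mul_sq_le_rpow_two_div hV.exponent_pos hV.lower_pos.le (norm_nonneg _) (hV.growth x).1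

theorem rpow_le_mul_sq (x : EuclideanSpace ℝ (Fin d)) :
    V x ^ (2 / a) ≤ C₂ ^ (2 / a) * ‖x - xs‖ ^ 2 :=
  rpow_two_div_le_mul_sq hV.exponent_pos hV.upper_pos.le (norm_nonneg _) (hV.nonneg x)
    (hV.growth x).2

theorem smul_sub_eq_zero_of_isProximalPoint (hμ : 0 < μ)
    (hu : IsProximalPoint (fun z => V z ^ (2 / a)) μ x xs) : μ⁻¹ • (x - xs) = 0 :=
  have hnonneg : ∀ z, 0 ≤ V z ^ (2 / a) := fun z => Real.rpow_nonneg (hV.nonneg z) _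
  hu.smul_sub_eq_of_hasGradientAt hnonneg hμ
    (hasGradientAt_zero_of_le_sq hnonneg hV.rpow_le_mul_sq)

theorem inner_proximal_le (hμ : 0 < μ) (hu : IsProximalPoint (fun z => V z ^ (2 / a)) μ x u) :
    inner ℝ (μ⁻¹ • (x - u)) (F u) ≤ -(2 * γ / a * C₁ ^ (2 / a) * ‖u - xs‖ ^ 2) := by
  have ha := hV.exponent_pos
  have hγ := hV.rate_pos
  rcases eq_or_ne u xs with rfl | hne
  · simp [hV.smul_sub_eq_zero_of_isProximalPoint hμ hu]
  have hVu := hV.pos_of_ne hne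
  have hchain := hV.inner_le u _
    (hu.smul_mem_clarkeGradient (by positivity) hV.locallyLipschitz hV.nonneg hμ hVu)
  rw [real_inner_smul_left, ← le_div_iff₀' (by positivity)] at hchain
  calc _ ≤ -γ * V u / ((2 / a)⁻¹ * V u ^ (1 - 2 / a)) := hchain
    _ = -(2 * γ / a * V u ^ (2 / a)) := by
        rw [Real.rpow_sub hVu, Real.rpow_one]
        field_simp
    _ ≤ -(2 * γ / a * C₁ ^ (2 / a) * ‖u - xs‖ ^ 2) := by
        rw [neg_le_neg_iff, mul_assoc]
        gcongr
        exact hV.mul_sq_le_rpow u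

theorem norm_proximal_le (hμ : 0 < μ) (hu : IsProximalPoint (fun z => V z ^ (2 / a)) μ x u) :
    ‖μ⁻¹ • (x - u)‖ ≤ gradientConst a G C₁ C₂ * ‖u - xs‖ := by
  have ha := hV.exponent_pos
  have hG := hV.gradient_pos
  rcases eq_or_ne u xs with rfl | hne
  · simp [hV.smul_sub_eq_zero_of_isProximalPoint hμ hu]
  have hVu := hV.pos_of_ne hne
  have hr : 0 < ‖u - xs‖ := norm_sub_pos_iff.2 hne
  have hchain := hV.norm_le u _
    (hu.smul_mem_clarkeGradient (by positivity) hV.locallyLipschitz hV.nonneg hμ hVu)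
  rw [norm_smul, Real.norm_of_nonneg (by positivity), ← le_div_iff₀' (by positivity)] at hchain
  calc _ ≤ G * ‖u - xs‖ ^ (a - 1) / ((2 / a)⁻¹ * V u ^ (1 - 2 / a)) := hchain
    _ = 2 / a * G * ‖u - xs‖ ^ (a - 1) * V u ^ (2 / a - 1) := by
        rw [← neg_sub (2 / a) 1, Real.rpow_neg hVu.le]
        field_simp
    _ ≤ 2 / a * G * ‖u - xs‖ ^ (a - 1) * (max (C₁ ^ (2 / a - 1)) (C₂ ^ (2 / a - 1))
          * (‖u - xs‖ ^ a) ^ (2 / a - 1)) := by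
        gcongr
        exact rpow_le_max_mul_rpow hV.lower_pos hV.upper_pos.le (by positivity)
          (hV.growth u).1 (hV.growth u).2 _
    _ = gradientConst a G C₁ C₂ * (‖u - xs‖ ^ (a - 1) * (‖u - xs‖ ^ a) ^ (2 / a - 1)) := by
        rw [gradientConst]
        ring
    _ = gradientConst a G C₁ C₂ * ‖u - xs‖ := by
        rw [← Real.rpow_mul hr.le, ← Real.rpow_add hr,
          show a - 1 + a * (2 / a - 1) = 1 by field_simp; ring, Real.rpow_one]

theorem hasProximalDrift (hC : 0 ≤ C) (hF : ∀ x y, ‖F x - F y‖ ≤ C * ‖x - y‖) (hμ : 0 < μ)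
    (hγM : 0 ≤ driftConst a γ C G C₁ C₂ μ) :
    HasProximalDrift F (fun z => V z ^ (2 / a)) μ (driftConst a γ C G C₁ C₂ μ) := by
  intro x u hu
  have ha := hV.exponent_pos
  have hc₂ : 0 < C₂ ^ (2 / a) := Real.rpow_pos_of_pos hV.upper_pos _
  have hM : moreauEnvelope (fun z => V z ^ (2 / a)) μ x ≤ C₂ ^ (2 / a) * ‖x - xs‖ ^ 2 :=
    (moreauEnvelope_le_self (fun z => Real.rpow_nonneg (hV.nonneg z) _) hμ x).trans
      (hV.rpow_le_mul_sq x)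
  set L := gradientConst a G C₁ C₂ with hL
  set b := 2 * γ / a * C₁ ^ (2 / a) / (1 + μ * L) ^ 2 - μ * C * L ^ 2 with hb
  have hdef : driftConst a γ C G C₁ C₂ μ = b / C₂ ^ (2 / a) := by
    rw [driftConst, Real.rpow_neg hV.upper_pos.le, ← hL, hb, div_eq_mul_inv]
    field_simp
  have hb₀ : 0 ≤ b := by simpa [hdef, le_div_iff₀ hc₂] using hγM
  calc inner ℝ (μ⁻¹ • (x - u)) (F x) ≤ -(b * ‖x - xs‖ ^ 2) :=
        inner_le_neg_mul_sq_of_sub_eq_smul hμ.le hC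
          (gradientConst_pos ha hV.gradient_pos hV.lower_pos).le (smul_inv_smul₀ hμ.ne' _).symm
          (hF x u) (hV.inner_proximal_le hμ hu) (hV.norm_proximal_le hμ hu) hb₀
    _ = -(b / C₂ ^ (2 / a)) * (C₂ ^ (2 / a) * ‖x - xs‖ ^ 2) := by field_simp
    _ ≤ -driftConst a γ C G C₁ C₂ μ * moreauEnvelope (fun z => V z ^ (2 / a)) μ x := by
        rw [hdef, neg_mul, neg_mul, neg_le_neg_iff]
        gcongr

theorem continuous_rpow : Continuous fun z => V z ^ (2 / a) :=
  have ha : 0 ≤ 2 / a := div_nonneg zero_le_two hV.exponent_pos.le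
  hV.locallyLipschitz.continuous.rpow_const fun _ => .inr ha

theorem inner_le_of_mem_clarkeGradient_moreauEnvelope (hC : 0 ≤ C)
    (hF : ∀ x y, ‖F x - F y‖ ≤ C * ‖x - y‖) (hμ : 0 < μ) (hγM : 0 ≤ driftConst a γ C G C₁ C₂ μ)
    {g : EuclideanSpace ℝ (Fin d)}
    (hg : g ∈ clarkeGradient (moreauEnvelope (fun z => V z ^ (2 / a)) μ) x) :
    inner ℝ g (F x)
      ≤ -driftConst a γ C G C₁ C₂ μ * moreauEnvelope (fun z => V z ^ (2 / a)) μ x :=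
  (hV.hasProximalDrift hC hF hμ hγM).inner_le_of_mem_clarkeGradient
    (continuous_of_norm_sub_le hF) (fun z => Real.rpow_nonneg (hV.nonneg z) _) hV.continuous_rpow
    hμ hg

end IsLyapunovFunction

end Drift

section Noise

variable {Ω E : Type*} {m mΩ : MeasurableSpace Ω} {P : Measure Ω} [NormedAddCommGroup E]
  {X Y W : Ω → E}

theorem integral_norm_sq_le_of_condExp_le [IsProbabilityMeasure P] (hm : m ≤ mΩ) {A B : ℝ}
    (hB : 0 ≤ B) (hX : MemLp X 2 P)
    (hvar : P[fun ω => ‖W ω‖ ^ 2 | m] ≤ᵐ[P] fun ω => A + B * ‖X ω‖ ^ 2) (x₀ : E) :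
    ∫ ω, ‖W ω‖ ^ 2 ∂P ≤ A + 2 * B * ‖x₀‖ ^ 2 + 2 * B * ∫ ω, ‖X ω - x₀‖ ^ 2 ∂P := by
  have hint : Integrable (fun ω => 2 * B * ‖X ω - x₀‖ ^ 2) P :=
    ((hX.sub (memLp_const x₀)).integrable_norm_pow two_ne_zero).const_mul _
  have hsq : ∀ y, ‖y‖ ^ 2 ≤ 2 * (‖y - x₀‖ ^ 2 + ‖x₀‖ ^ 2) := fun y =>
    calc ‖y‖ ^ 2 ≤ (‖y - x₀‖ + ‖x₀‖) ^ 2 := by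
          gcongr
          exact norm_le_norm_sub_add y x₀
      _ ≤ 2 * (‖y - x₀‖ ^ 2 + ‖x₀‖ ^ 2) := add_sq_le
  calc ∫ ω, ‖W ω‖ ^ 2 ∂P = ∫ ω, (P[fun ω => ‖W ω‖ ^ 2 | m]) ω ∂P := (integral_condExp hm).symm
    _ ≤ ∫ ω, (A + 2 * B * ‖x₀‖ ^ 2 + 2 * B * ‖X ω - x₀‖ ^ 2) ∂P := by
        refine integral_mono_ae integrable_condExp ((integrable_const _).add hint) ?_
        filter_upwards [hvar] with ω hω
        linarith [mul_le_mul_of_nonneg_left (hsq (X ω)) hB]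
    _ = A + 2 * B * ‖x₀‖ ^ 2 + 2 * B * ∫ ω, ‖X ω - x₀‖ ^ 2 ∂P := by
        rw [integral_add (integrable_const _) hint, integral_const_mul, integral_const,
          probReal_univ, one_smul]

theorem condExp_add_smul_ae_eq [NormedSpace ℝ E] [CompleteSpace E] [IsFiniteMeasure P]
    (hm : m ≤ mΩ) (hYm : StronglyMeasurable[m] Y) (hY : Integrable Y P) (hW : Integrable W P)
    (hmean : P[W | m] =ᵐ[P] 0) (β : ℝ) : P[Y + β • W | m] =ᵐ[P] Y := by
  filter_upwards [condExp_add hY (hW.smul β) m, condExp_smul (μ := P) β W m, hmean]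
    with ω hadd hsmul hzero
  rw [hadd, Pi.add_apply, hsmul, Pi.smul_apply, hzero, condExp_of_stronglyMeasurable hm hYm hY]
  simp

theorem integral_comp_add_smul_le_of_concaveOn [NormedSpace ℝ E] [FiniteDimensional ℝ E]
    [IsFiniteMeasure P] (hm : m ≤ mΩ) {φ : E → ℝ} (hφ : ConcaveOn ℝ univ φ) {β : ℝ}
    (hYm : StronglyMeasurable[m] Y) (hY : Integrable Y P) (hW : Integrable W P)
    (hmean : P[W | m] =ᵐ[P] 0) (hφY : Integrable (fun ω => φ (Y ω)) P)
    (hφYW : Integrable (fun ω => φ (Y ω + β • W ω)) P) :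
    ∫ ω, φ (Y ω + β • W ω) ∂P ≤ ∫ ω, φ (Y ω) ∂P := by
  have : CompleteSpace E := FiniteDimensional.complete ℝ E
  have hjensen : P[φ ∘ (Y + β • W) | m] ≤ᵐ[P] φ ∘ P[Y + β • W | m] :=
    hφ.condExp_map_le_of_finiteDimensional hm (hY.add (hW.smul β)) hφYW
  calc ∫ ω, φ (Y ω + β • W ω) ∂P = ∫ ω, (P[φ ∘ (Y + β • W) | m]) ω ∂P :=
        (integral_condExp hm).symm
    _ ≤ ∫ ω, φ (Y ω) ∂P := by
        refine integral_mono_ae integrable_condExp hφY ?_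
        filter_upwards [hjensen, condExp_add_smul_ae_eq hm hYm hY hW hmean β] with ω hle heq
        rwa [Function.comp_apply, heq] at hle

variable [InnerProductSpace ℝ E]

theorem integrable_inner_of_memLp_two (hX : MemLp X 2 P) (hY : MemLp Y 2 P) :
    Integrable (fun ω => inner ℝ (X ω) (Y ω)) P :=
  (hX.norm.integrable_mul hY.norm).mono' (hX.aestronglyMeasurable.inner hY.aestronglyMeasurable)
    (.of_forall fun _ => norm_inner_le_norm _ _)

theorem integral_inner_eq_zero_of_condExp_eq_zero [CompleteSpace E] [IsFiniteMeasure P]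
    (hm : m ≤ mΩ) (hYm : StronglyMeasurable[m] Y) (hY : MemLp Y 2 P) (hW : MemLp W 2 P)
    (hmean : P[W | m] =ᵐ[P] 0) : ∫ ω, inner ℝ (Y ω) (W ω) ∂P = 0 := by
  have hpull : P[fun ω => inner ℝ (Y ω) (W ω) | m] =ᵐ[P] fun ω => inner ℝ (Y ω) (P[W | m] ω) :=
    condExp_bilin_of_stronglyMeasurable_left (innerSL ℝ) hYm (integrable_inner_of_memLp_two hY hW)
      (hW.integrable one_le_two)
  rw [← integral_condExp hm, integral_eq_zero_of_ae]
  filter_upwards [hpull, hmean] with ω hω hzero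
  simp [hω, hzero]

theorem integral_norm_add_smul_sq_of_condExp_eq_zero [CompleteSpace E] [IsFiniteMeasure P]
    (hm : m ≤ mΩ) (hYm : StronglyMeasurable[m] Y) (hY : MemLp Y 2 P) (hW : MemLp W 2 P)
    (hmean : P[W | m] =ᵐ[P] 0) (β : ℝ) :
    ∫ ω, ‖Y ω + β • W ω‖ ^ 2 ∂P = ∫ ω, ‖Y ω‖ ^ 2 ∂P + β ^ 2 * ∫ ω, ‖W ω‖ ^ 2 ∂P := by
  have hYsq : Integrable (fun ω => ‖Y ω‖ ^ 2) P := hY.integrable_norm_pow two_ne_zero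
  have hWsq : Integrable (fun ω => β ^ 2 * ‖W ω‖ ^ 2) P :=
    (hW.integrable_norm_pow two_ne_zero).const_mul _
  have hinner : Integrable (fun ω => 2 * β * inner ℝ (Y ω) (W ω)) P :=
    (integrable_inner_of_memLp_two hY hW).const_mul _
  have hYinner : Integrable (fun ω => ‖Y ω‖ ^ 2 + 2 * β * inner ℝ (Y ω) (W ω)) P := hYsq.add hinner
  calc ∫ ω, ‖Y ω + β • W ω‖ ^ 2 ∂P
      = ∫ ω, (‖Y ω‖ ^ 2 + 2 * β * inner ℝ (Y ω) (W ω) + β ^ 2 * ‖W ω‖ ^ 2) ∂P := by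
        simp only [norm_add_sq_real, real_inner_smul_right, norm_smul, mul_pow, Real.norm_eq_abs,
          sq_abs, mul_assoc]
    _ = ∫ ω, ‖Y ω‖ ^ 2 ∂P + β ^ 2 * ∫ ω, ‖W ω‖ ^ 2 ∂P := by
        rw [integral_add hYinner hWsq, integral_add hYsq hinner, integral_const_mul,
          integral_const_mul, integral_inner_eq_zero_of_condExp_eq_zero hm hYm hY hW hmean,
          mul_zero, add_zero]

end Noise

section OneStep

variable {Ω : Type*} {m mΩ : MeasurableSpace Ω} {P : Measure Ω} {d : ℕ}
  {F : EuclideanSpace ℝ (Fin d) → EuclideanSpace ℝ (Fin d)} {R : EuclideanSpace ℝ (Fin d) → ℝ}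
  {xs : EuclideanSpace ℝ (Fin d)} {X Y W : Ω → EuclideanSpace ℝ (Fin d)}
  {A B C β γ μ c₁ c₂ : ℝ}

theorem memLp_comp_of_norm_le {E G : Type*} [NormedAddCommGroup E] [NormedAddCommGroup G]
    [IsFiniteMeasure P] {p : ENNReal} {F : E → G} {x₀ : E} {X : Ω → E} (hF : Continuous F)
    (hFle : ∀ z, ‖F z‖ ≤ C * ‖z - x₀‖) (hX : MemLp X p P) : MemLp (fun ω => F (X ω)) p P :=
  (hX.sub (memLp_const x₀)).of_le_mul (hF.comp_aestronglyMeasurable hX.aestronglyMeasurable)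
    (.of_forall fun ω => hFle (X ω))

theorem integrable_moreauEnvelope_comp [IsFiniteMeasure P] (hR : ∀ z, 0 ≤ R z)
    (hRc : Continuous R) (hR₂ : ∀ z, R z ≤ c₂ * ‖z - xs‖ ^ 2) (hμ : 0 < μ) (hX : MemLp X 2 P) :
    Integrable (fun ω => moreauEnvelope R μ (X ω)) P := by
  have hsq : Integrable (fun ω => c₂ * ‖X ω - xs‖ ^ 2) P :=
    ((hX.sub (memLp_const xs)).integrable_norm_pow two_ne_zero).const_mul c₂
  refine hsq.mono' ((continuous_moreauEnvelope hR hRc hμ).comp_aestronglyMeasurable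
    hX.aestronglyMeasurable) (.of_forall fun ω => ?_)
  rw [Real.norm_of_nonneg (moreauEnvelope_nonneg hR hμ _)]
  exact (moreauEnvelope_le_self hR hμ _).trans (hR₂ _)

theorem integral_moreauEnvelope_add_noise_le [IsFiniteMeasure P] (hm : m ≤ mΩ)
    (hR : ∀ z, 0 ≤ R z) (hRc : Continuous R) (hR₂ : ∀ z, R z ≤ c₂ * ‖z - xs‖ ^ 2) (hμ : 0 < μ)
    (hYm : StronglyMeasurable[m] Y) (hY : MemLp Y 2 P) (hW : MemLp W 2 P)
    (hmean : P[W | m] =ᵐ[P] 0) (β : ℝ) :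
    ∫ ω, moreauEnvelope R μ (Y ω + β • W ω) ∂P
      ≤ ∫ ω, moreauEnvelope R μ (Y ω) ∂P + β ^ 2 / (2 * μ) * ∫ ω, ‖W ω‖ ^ 2 ∂P := by
  have hYW : MemLp (fun ω => Y ω + β • W ω) 2 P := hY.add (hW.const_smul β)
  have hMY := integrable_moreauEnvelope_comp hR hRc hR₂ hμ hY
  have hMYW := integrable_moreauEnvelope_comp hR hRc hR₂ hμ hYW
  have hsqY : Integrable (fun ω => ‖Y ω‖ ^ 2 / (2 * μ)) P :=
    (hY.integrable_norm_pow two_ne_zero).div_const _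
  have hsqYW : Integrable (fun ω => ‖Y ω + β • W ω‖ ^ 2 / (2 * μ)) P :=
    (hYW.integrable_norm_pow two_ne_zero).div_const _
  have hconcave := integral_comp_add_smul_le_of_concaveOn hm
    (concaveOn_moreauEnvelope_sub_norm_sq hR hRc hμ) (β := β) hYm (hY.integrable one_le_two)
    (hW.integrable one_le_two) hmean (hMY.sub hsqY) (hMYW.sub hsqYW)
  rw [integral_sub hMYW hsqYW, integral_sub hMY hsqY, integral_div, integral_div,
    integral_norm_add_smul_sq_of_condExp_eq_zero hm hYm hY hW hmean, add_div, mul_div_right_comm]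
    at hconcave
  linarith

theorem HasProximalDrift.moreauEnvelope_add_smul_le (hdrift : HasProximalDrift F R μ γ)
    (hR : ∀ z, 0 ≤ R z) (hRc : Continuous R) (hμ : 0 < μ) (hβ : 0 ≤ β)
    (x : EuclideanSpace ℝ (Fin d)) :
    moreauEnvelope R μ (x + β • F x)
      ≤ (1 - β * γ) * moreauEnvelope R μ x + β ^ 2 / (2 * μ) * ‖F x‖ ^ 2 := by
  obtain ⟨u, hu⟩ := exists_isProximalPoint hR hRc hμ x
  have hexpand := hu.moreauEnvelope_le_add hR hμ (x + β • F x)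
  rw [add_sub_cancel_left, real_inner_smul_right, norm_smul, mul_pow, Real.norm_eq_abs, sq_abs,
    mul_div_right_comm] at hexpand
  linarith [mul_le_mul_of_nonneg_left (hdrift x u hu) hβ]

theorem integral_sq_norm_sub_le_mul_integral_moreauEnvelope [IsFiniteMeasure P] (hRc : Continuous R)
    (hc₁ : 0 < c₁) (hR₁ : ∀ z, c₁ * ‖z - xs‖ ^ 2 ≤ R z) (hR₂ : ∀ z, R z ≤ c₂ * ‖z - xs‖ ^ 2)
    (hμ : 0 < μ) (hX : MemLp X 2 P) :
    ∫ ω, ‖X ω - xs‖ ^ 2 ∂P ≤ (1 / c₁ + 2 * μ) * ∫ ω, moreauEnvelope R μ (X ω) ∂P := by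
  have hR : ∀ z, 0 ≤ R z := fun z => le_trans (by positivity) (hR₁ z)
  rw [← integral_const_mul]
  exact integral_mono ((hX.sub (memLp_const xs)).integrable_norm_pow two_ne_zero)
    ((integrable_moreauEnvelope_comp hR hRc hR₂ hμ hX).const_mul _)
    fun ω => sq_norm_sub_le_mul_moreauEnvelope hc₁ hR₁ hμ (X ω)

theorem HasProximalDrift.integral_moreauEnvelope_add_smul_le [IsFiniteMeasure P]
    (hdrift : HasProximalDrift F R μ γ) (hF : Continuous F) (hFle : ∀ z, ‖F z‖ ≤ C * ‖z - xs‖)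
    (hR : ∀ z, 0 ≤ R z) (hRc : Continuous R) (hR₂ : ∀ z, R z ≤ c₂ * ‖z - xs‖ ^ 2) (hμ : 0 < μ)
    (hβ : 0 ≤ β) (hX : MemLp X 2 P) :
    ∫ ω, moreauEnvelope R μ (X ω + β • F (X ω)) ∂P
      ≤ (1 - β * γ) * ∫ ω, moreauEnvelope R μ (X ω) ∂P
        + β ^ 2 / (2 * μ) * (C ^ 2 * ∫ ω, ‖X ω - xs‖ ^ 2 ∂P) := by
  have hFX : MemLp (fun ω => F (X ω)) 2 P := memLp_comp_of_norm_le hF hFle hX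
  have hM := (integrable_moreauEnvelope_comp hR hRc hR₂ hμ hX).const_mul (1 - β * γ)
  have hsq : Integrable (fun ω => ‖X ω - xs‖ ^ 2) P :=
    (hX.sub (memLp_const xs)).integrable_norm_pow two_ne_zero
  have hrest := (hsq.const_mul (C ^ 2)).const_mul (β ^ 2 / (2 * μ))
  calc ∫ ω, moreauEnvelope R μ (X ω + β • F (X ω)) ∂P
      ≤ ∫ ω, ((1 - β * γ) * moreauEnvelope R μ (X ω)
          + β ^ 2 / (2 * μ) * (C ^ 2 * ‖X ω - xs‖ ^ 2)) ∂P := by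
        refine integral_mono (integrable_moreauEnvelope_comp hR hRc hR₂ hμ
          (hX.add (hFX.const_smul β))) (hM.add hrest) fun ω => ?_
        refine (hdrift.moreauEnvelope_add_smul_le hR hRc hμ hβ (X ω)).trans ?_
        rw [← mul_pow]
        gcongr
        exact hFle (X ω)
    _ = _ := by
        rw [integral_add hM hrest, integral_const_mul, integral_const_mul, integral_const_mul]

/-- The noise and the drift both enter at second order only, through `𝔼 ‖X - xs‖ ^ 2`; for small
`β` these terms are absorbed by half of the drift. -/
theorem HasProximalDrift.integral_moreauEnvelope_step_le [IsProbabilityMeasure P] (hm : m ≤ mΩ)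
    (hdrift : HasProximalDrift F R μ γ) (hF : Continuous F) (hFle : ∀ z, ‖F z‖ ≤ C * ‖z - xs‖)
    (hRc : Continuous R) (hc₁ : 0 < c₁) (hR₁ : ∀ z, c₁ * ‖z - xs‖ ^ 2 ≤ R z)
    (hR₂ : ∀ z, R z ≤ c₂ * ‖z - xs‖ ^ 2) (hμ : 0 < μ) (hγ : 0 ≤ γ) (hA : 0 ≤ A) (hB : 0 ≤ B)
    (hβ : 0 ≤ β) (hβle : β * (2 * (C ^ 2 + 2 * B) * (1 / c₁ + 2 * μ)) ≤ γ * μ)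
    (hXm : StronglyMeasurable[m] X) (hX : MemLp X 2 P) (hW : MemLp W 2 P)
    (hmean : P[W | m] =ᵐ[P] 0)
    (hvar : P[fun ω => ‖W ω‖ ^ 2 | m] ≤ᵐ[P] fun ω => A + B * ‖X ω‖ ^ 2) :
    ∫ ω, moreauEnvelope R μ (X ω + β • (F (X ω) + W ω)) ∂P
      ≤ (1 - β * γ / 2) * ∫ ω, moreauEnvelope R μ (X ω) ∂P
        + β ^ 2 * ((A + 2 * B * ‖xs‖ ^ 2) / μ) := by
  have hR : ∀ z, 0 ≤ R z := fun z => le_trans (by positivity) (hR₁ z)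
  have hnoise := integral_moreauEnvelope_add_noise_le
    (Y := fun ω => X ω + β • F (X ω)) hm hR hRc hR₂ hμ
    (hXm.add ((hF.comp_stronglyMeasurable hXm).const_smul β))
    (hX.add ((memLp_comp_of_norm_le hF hFle hX).const_smul β)) hW hmean β
  have hdet := hdrift.integral_moreauEnvelope_add_smul_le hF hFle hR hRc hR₂ hμ hβ hX
  have hvariance := integral_norm_sq_le_of_condExp_le hm hB hX hvar xs
  have hdist := integral_sq_norm_sub_le_mul_integral_moreauEnvelope hRc hc₁ hR₁ hR₂ hμ hX
  have hM : 0 ≤ ∫ ω, moreauEnvelope R μ (X ω) ∂P :=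
    integral_nonneg fun ω => moreauEnvelope_nonneg hR hμ _
  simp only [smul_add, ← add_assoc]
  set M := ∫ ω, moreauEnvelope R μ (X ω) ∂P
  set ρ := ∫ ω, ‖X ω - xs‖ ^ 2 ∂P
  set N := A + 2 * B * ‖xs‖ ^ 2
  have : 0 ≤ N := by positivity
  have habsorb : β ^ 2 / (2 * μ) * ((C ^ 2 + 2 * B) * ρ) ≤ β * γ / 2 * M := by
    calc _ ≤ β ^ 2 / (2 * μ) * ((C ^ 2 + 2 * B) * ((1 / c₁ + 2 * μ) * M)) := by gcongr
      _ = β * (β * (2 * (C ^ 2 + 2 * B) * (1 / c₁ + 2 * μ))) / (4 * μ) * M := by ring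
      _ ≤ β * (γ * μ) / (4 * μ) * M := by gcongr
      _ = β * γ / 4 * M := by field_simp
      _ ≤ β * γ / 2 * M := by
          gcongr
          norm_num
  calc _ ≤ _ + β ^ 2 / (2 * μ) * ∫ ω, ‖W ω‖ ^ 2 ∂P := hnoise
    _ ≤ (1 - β * γ) * M + β ^ 2 / (2 * μ) * (C ^ 2 * ρ) + β ^ 2 / (2 * μ) * (N + 2 * B * ρ) := by
        gcongr
    _ = (1 - β * γ) * M + β ^ 2 / (2 * μ) * ((C ^ 2 + 2 * B) * ρ) + β ^ 2 * (N / (2 * μ)) := by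
        ring
    _ ≤ (1 - β * γ) * M + β * γ / 2 * M + β ^ 2 * (N / μ) := by
        gcongr
        linarith
    _ = (1 - β * γ / 2) * M + β ^ 2 * (N / μ) := by ring

end OneStep

section LinearRecursion

theorem one_add_mul_one_sub_inv_le_rpow {x r : ℝ} (hx : 0 < x) (hr : 0 ≤ r) :
    1 + r * (1 - x⁻¹) ≤ x ^ r :=
  calc 1 + r * (1 - x⁻¹) ≤ Real.log x * r + 1 := by
        rw [add_comm, mul_comm (Real.log x)]
        gcongr
        exact Real.one_sub_inv_le_log_of_pos hx
    _ ≤ Real.exp (Real.log x * r) := Real.add_one_le_exp _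
    _ = x ^ r := (Real.rpow_def_of_pos hx r).symm

theorem one_sub_div_le_div_add_one_rpow {n r : ℝ} (hn : 0 < n) (hr : 0 ≤ r) :
    1 - r / n ≤ (n / (n + 1)) ^ r := by
  convert one_add_mul_one_sub_inv_le_rpow (div_pos hn (add_pos hn one_pos)) hr using 1
  field_simp
  ring

theorem rpow_mul_one_add_div_le {n r : ℝ} (hn : 0 < n) (hr : 0 ≤ r) :
    n ^ r * (1 + r / (n + 1)) ≤ (n + 1) ^ r := by
  have hle := one_add_mul_one_sub_inv_le_rpow (div_pos (add_pos hn one_pos) hn) hr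
  rw [Real.div_rpow (by positivity) hn.le, le_div_iff₀' (by positivity)] at hle
  calc n ^ r * (1 + r / (n + 1)) = n ^ r * (1 + r * (1 - ((n + 1) / n)⁻¹)) := by
        field_simp
        ring
    _ ≤ (n + 1) ^ r := hle

theorem add_one_rpow_sub_rpow_le {n s : ℝ} (hn : 0 < n) (hs : 0 ≤ s) (hs₁ : s ≤ 1) :
    (n + 1) ^ s - n ^ s ≤ s * n ^ (s - 1) := by
  have hbernoulli : (1 + n⁻¹) ^ s ≤ 1 + s * n⁻¹ :=
    rpow_one_add_le_one_add_mul_self (by linarith [inv_pos.2 hn]) hs hs₁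
  have hfactor : (n + 1) ^ s = n ^ s * (1 + n⁻¹) ^ s := by
    rw [← Real.mul_rpow hn.le (by positivity), mul_add, mul_one, mul_inv_cancel₀ hn.ne']
  rw [hfactor, Real.rpow_sub_one hn.ne']
  calc n ^ s * (1 + n⁻¹) ^ s - n ^ s ≤ n ^ s * (1 + s * n⁻¹) - n ^ s := by gcongr
    _ = s * (n ^ s / n) := by ring

/-- `u` satisfies `u (k + 1) ≤ (1 - q k) u k + e k` with damping rates `q k ≤ 1`, starting from an
initial value that is at most `u₀`. -/
structure DampedRecursion (u₀ : ℝ) (q e u : ℕ → ℝ) : Prop where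
  nonneg_zero : 0 ≤ u 0
  le_initial : u 0 ≤ u₀
  rate_le_one : ∀ k, q k ≤ 1
  step_le : ∀ k, u (k + 1) ≤ (1 - q k) * u k + e k

/-- The bound `Z u₀ + S` on the `k`-th term of every sequence damped at rates `β j γ / 2` and forced
by `β j ^ 2 D`. The part `S` due to the forcing is required to be nonnegative. -/
structure IsRecursionBound (β : ℕ → ℝ) (γ D : ℝ) (k : ℕ) (Z S : ℝ) : Prop where
  nonneg : 0 ≤ S
  le : ∀ u₀ u, DampedRecursion u₀ (fun j => β j * γ / 2) (fun j => β j ^ 2 * D) u →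
    u k ≤ u₀ * Z + S

/-- The step sizes `α_k = α / (k + K) ^ ξ`. -/
noncomputable def stepSize (α K ξ : ℝ) (k : ℕ) : ℝ := α / ((k : ℝ) + K) ^ ξ

theorem stepSize_nonneg {α K ξ : ℝ} (hα : 0 ≤ α) (hK : 0 ≤ K) (k : ℕ) : 0 ≤ stepSize α K ξ k := by
  unfold stepSize
  positivity

theorem stepSize_zero (α K : ℝ) (k : ℕ) : stepSize α K 0 k = α := by simp [stepSize]

theorem stepSize_le {α K ξ m : ℝ} (hα : 0 ≤ α) (hK : 0 < K) (hξ : 0 < ξ) (hm : 0 < m)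
    (h : (α / m) ^ (1 / ξ) ≤ K) (k : ℕ) : stepSize α K ξ k ≤ m := by
  rw [one_div, Real.rpow_inv_le_iff_of_pos (by positivity) hK.le hξ] at h
  rw [stepSize, div_le_comm₀ (by positivity) hm]
  exact h.trans (Real.rpow_le_rpow hK.le (le_add_of_nonneg_left k.cast_nonneg) hξ.le)

namespace DampedRecursion

variable {u₀ p r K : ℝ} {q e u : ℕ → ℝ}

theorem initial_nonneg (hu : DampedRecursion u₀ q e u) : 0 ≤ u₀ :=
  hu.nonneg_zero.trans hu.le_initial

theorem le_supersolution (hu : DampedRecursion u₀ q e u) {b : ℕ → ℝ} (hb₀ : u₀ ≤ b 0)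
    (hb : ∀ k, (1 - q k) * b k + e k ≤ b (k + 1)) (k : ℕ) : u k ≤ b k := by
  induction k with
  | zero => exact hu.le_initial.trans hb₀
  | succ k ih =>
    calc u (k + 1) ≤ (1 - q k) * u k + e k := hu.step_le k
      _ ≤ (1 - q k) * b k + e k :=
        add_le_add_left (mul_le_mul_of_nonneg_left ih (sub_nonneg.2 (hu.rate_le_one k))) _
      _ ≤ b (k + 1) := hb k

theorem le_of_const (hq : 0 < p) (hr : 0 ≤ r) (hu : DampedRecursion u₀ (fun _ => p) (fun _ => r) u)
    (k : ℕ) : u k ≤ u₀ * (1 - p) ^ k + r / p := by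
  refine hu.le_supersolution (b := fun k => u₀ * (1 - p) ^ k + r / p) ?_ (fun k => ?_) k
  · simpa using div_nonneg hr hq.le
  · refine le_of_eq ?_
    field_simp
    ring

/-- Multiplication by `1 - p / n` turns `n ^ (-p)` into at most `(n + 1) ^ (-p)`, so the forcing
only has to be absorbed by the increments of `τ`. -/
theorem le_of_harmonic {τ : ℝ → ℝ} (hK : 0 < K) (hp : 0 ≤ p) (hr : 0 ≤ r)
    (hu : DampedRecursion u₀ (fun k => p / (k + K)) (fun k => r / (k + K) ^ 2) u)
    (hτ₀ : ∀ n, K ≤ n → 0 ≤ τ n)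
    (hτ : ∀ n, K ≤ n → 1 / (4 * n ^ 2) ≤ (n + 1) ^ (-p) * (τ (n + 1) - τ n)) (k : ℕ) :
    u k ≤ u₀ * (K / (k + K)) ^ p + 4 * r * ((k + K) ^ (-p) * τ (k + K)) := by
  have hrpow : ∀ n : ℝ, 0 < n → (K / n) ^ p = K ^ p * n ^ (-p) := fun n hn => by
    rw [Real.div_rpow hK.le hn.le, Real.rpow_neg hn.le, div_eq_mul_inv]
  refine hu.le_supersolution
    (b := fun k : ℕ => u₀ * (K / (k + K)) ^ p + 4 * r * ((k + K) ^ (-p) * τ (k + K)))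
    ?_ (fun k => ?_) k
  · have hforcing : 0 ≤ 4 * r * (K ^ (-p) * τ K) :=
      mul_nonneg (by positivity) (mul_nonneg (by positivity) (hτ₀ K le_rfl))
    simpa [div_self hK.ne'] using hforcing
  · have hKn : K ≤ k + K := le_add_of_nonneg_left k.cast_nonneg
    rw [Nat.cast_succ, add_right_comm (k : ℝ) 1 K]
    set n : ℝ := k + K
    have hn : 0 < n := hK.trans_le hKn
    rw [hrpow n hn, hrpow (n + 1) (by positivity)]
    have hdamp : (1 - p / n) * n ^ (-p) ≤ (n + 1) ^ (-p) := by
      rw [Real.rpow_neg hn.le, Real.rpow_neg (by positivity), ← div_eq_mul_inv,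
        div_le_iff₀ (by positivity), ← div_eq_inv_mul, ← Real.div_rpow hn.le (by positivity)]
      exact one_sub_div_le_div_add_one_rpow hn hp
    have hgap : 0 ≤ u₀ * K ^ p + 4 * r * τ n :=
      add_nonneg (mul_nonneg hu.initial_nonneg (by positivity))
        (mul_nonneg (by positivity) (hτ₀ n hKn))
    calc (1 - p / n) * (u₀ * (K ^ p * n ^ (-p)) + 4 * r * (n ^ (-p) * τ n)) + r / n ^ 2
        = (1 - p / n) * n ^ (-p) * (u₀ * K ^ p + 4 * r * τ n) + 4 * r * (1 / (4 * n ^ 2)) := by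
          field_simp
      _ ≤ (n + 1) ^ (-p) * (u₀ * K ^ p + 4 * r * τ n)
          + 4 * r * ((n + 1) ^ (-p) * (τ (n + 1) - τ n)) := by
          gcongr
          exact hτ n hKn
      _ = u₀ * (K ^ p * (n + 1) ^ (-p)) + 4 * r * ((n + 1) ^ (-p) * τ (n + 1)) := by ring

end DampedRecursion

section HarmonicIncrement

variable {n p : ℝ}

theorem one_div_four_mul_sq_le (hn : 1 ≤ n) : 1 / (4 * n ^ 2) ≤ 1 / (n + 1) ^ 2 := by
  gcongr
  nlinarith

theorem rpow_neg_mul_rpow_sub_one (hn : 0 < n) : n ^ (-p) * n ^ (p - 1) = n⁻¹ := by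
  rw [← Real.rpow_add hn, ← Real.rpow_neg_one]
  congr 1
  ring

theorem one_div_four_mul_sq_le_of_lt_one (hn : 1 ≤ n) (hp : p < 1) :
    1 / (4 * n ^ 2) ≤ (n + 1) ^ (-p) * ((n ^ (p - 1) - (n + 1) ^ (p - 1)) / (1 - p)) := by
  have hn₀ : 0 < n := one_pos.trans_le hn
  have hp₁ : 0 < 1 - p := sub_pos.2 hp
  have hdecrease : (n + 1) ^ (p - 1) * (1 + (1 - p) / (n + 1)) ≤ n ^ (p - 1) := by
    have hle := rpow_mul_one_add_div_le hn₀ hp₁.le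
    rw [← neg_sub 1 p, Real.rpow_neg hn₀.le, Real.rpow_neg (by positivity), ← div_eq_inv_mul,
      div_le_iff₀ (by positivity), inv_mul_eq_div, le_div_iff₀' (by positivity)]
    exact hle
  calc 1 / (4 * n ^ 2) ≤ 1 / (n + 1) ^ 2 := one_div_four_mul_sq_le hn
    _ = (n + 1) ^ (-p) * (n + 1) ^ (p - 1) * ((1 - p) / (n + 1) / (1 - p)) := by
        rw [rpow_neg_mul_rpow_sub_one (by positivity)]
        field_simp
    _ = (n + 1) ^ (-p) * (((n + 1) ^ (p - 1) * (1 + (1 - p) / (n + 1)) - (n + 1) ^ (p - 1))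
          / (1 - p)) := by ring
    _ ≤ (n + 1) ^ (-p) * ((n ^ (p - 1) - (n + 1) ^ (p - 1)) / (1 - p)) := by gcongr

theorem one_div_four_mul_sq_le_log_sub_log (hn : 1 ≤ n) :
    1 / (4 * n ^ 2) ≤ (n + 1) ^ (-1 : ℝ) * (Real.log (n + 1) - Real.log n) := by
  have hn₀ : 0 < n := one_pos.trans_le hn
  rw [← Real.log_div (by positivity) hn₀.ne', Real.rpow_neg_one]
  calc 1 / (4 * n ^ 2) ≤ 1 / (n + 1) ^ 2 := one_div_four_mul_sq_le hn
    _ = (n + 1)⁻¹ * (1 - ((n + 1) / n)⁻¹) := by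
        field_simp
        ring
    _ ≤ (n + 1)⁻¹ * Real.log ((n + 1) / n) := by
        gcongr
        exact Real.one_sub_inv_le_log_of_pos (by positivity)

theorem one_div_four_mul_sq_le_of_one_lt (hn : 1 ≤ n) (hp : 1 < p) (hpn : p ≤ n) :
    1 / (4 * n ^ 2) ≤ (n + 1) ^ (-p) * (((n + 1) ^ (p - 1) - n ^ (p - 1)) / (p - 1)) := by
  have hn₀ : 0 < n := one_pos.trans_le hn
  have hp₁ : 0 < p - 1 := sub_pos.2 hp
  have hincrease : n ^ (p - 1) ≤ (n + 1) ^ (p - 1) * ((n + 1) / (n + p)) := by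
    have hle := rpow_mul_one_add_div_le hn₀ hp₁.le
    rw [one_add_div (by positivity), add_add_sub_cancel, ← le_div_iff₀ (by positivity),
      div_div_eq_mul_div, mul_div_assoc] at hle
    exact hle
  calc 1 / (4 * n ^ 2) ≤ 1 / ((n + 1) * (n + p)) :=
        one_div_le_one_div_of_le (by positivity) (by nlinarith)
    _ = (n + 1) ^ (-p) * (n + 1) ^ (p - 1) * ((1 - (n + 1) / (n + p)) / (p - 1)) := by
        rw [rpow_neg_mul_rpow_sub_one (by positivity)]
        field_simp
        ring
    _ = (n + 1) ^ (-p) * (((n + 1) ^ (p - 1) - (n + 1) ^ (p - 1) * ((n + 1) / (n + p)))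
          / (p - 1)) := by ring
    _ ≤ (n + 1) ^ (-p) * (((n + 1) ^ (p - 1) - n ^ (p - 1)) / (p - 1)) := by gcongr

end HarmonicIncrement

namespace DampedRecursion

variable {u₀ p r D K α γ : ℝ} {u : ℕ → ℝ}

section Harmonic

variable (hu : DampedRecursion u₀ (fun k => p / (k + K)) (fun k => r / (k + K) ^ 2) u)
include hu

theorem le_of_harmonic_of_lt_one (hK : 1 ≤ K) (hp : 0 ≤ p) (hp₁ : p < 1) (hr : 0 ≤ r) (k : ℕ) :
    u k ≤ u₀ * (K / (k + K)) ^ p + 4 * r * (1 / (k + K) ^ p / (1 - p)) := by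
  have hK₀ : 0 < K := one_pos.trans_le hK
  have hp₁' : 0 < 1 - p := sub_pos.2 hp₁
  refine (hu.le_of_harmonic (τ := fun n => (1 - n ^ (p - 1)) / (1 - p)) hK₀ hp hr
    (fun n hn => ?_) (fun n hn => ?_) k).trans ?_
  · have hle : n ^ (p - 1) ≤ 1 :=
      Real.rpow_le_one_of_one_le_of_nonpos (hK.trans hn) (sub_nonpos.2 hp₁.le)
    exact div_nonneg (sub_nonneg.2 hle) hp₁'.le
  · rw [← sub_div, sub_sub_sub_cancel_left]
    exact one_div_four_mul_sq_le_of_lt_one (hK.trans hn) hp₁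
  · have hn : 0 < (k : ℝ) + K := by positivity
    rw [Real.rpow_neg hn.le, ← mul_div_assoc, one_div]
    gcongr
    exact mul_le_of_le_one_right (by positivity) (sub_le_self _ (by positivity))

theorem le_of_harmonic_of_eq_one (hK : 1 ≤ K) (hp : p = 1) (hr : 0 ≤ r) (k : ℕ) :
    u k ≤ u₀ * (K / (k + K)) ^ p + 4 * r * (Real.log (k + K) / (k + K)) := by
  subst hp
  refine (hu.le_of_harmonic (τ := Real.log) (one_pos.trans_le hK) zero_le_one hr
    (fun n hn => Real.log_nonneg (hK.trans hn))
    (fun n hn => one_div_four_mul_sq_le_log_sub_log (hK.trans hn)) k).trans_eq ?_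
  rw [Real.rpow_neg_one, inv_mul_eq_div]

theorem le_of_harmonic_of_one_lt (hK : 1 ≤ K) (hp : 1 < p) (hr : 0 ≤ r) (k : ℕ) :
    u k ≤ u₀ * (K / (k + K)) ^ p + 4 * r * (1 / (k + K) / (p - 1)) := by
  have hK₀ : 0 < K := one_pos.trans_le hK
  have hpK : p ≤ K := by
    have hrate := hu.rate_le_one 0
    rwa [Nat.cast_zero, zero_add, div_le_one hK₀] at hrate
  refine (hu.le_of_harmonic (τ := fun n => n ^ (p - 1) / (p - 1)) hK₀ (one_pos.trans hp).le hr
    (fun n hn => ?_) (fun n hn => ?_) k).trans_eq ?_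
  · exact div_nonneg (Real.rpow_nonneg (hK₀.le.trans hn) _) (sub_nonneg.2 hp.le)
  · rw [← sub_div]
    exact one_div_four_mul_sq_le_of_one_lt (hK.trans hn) hp (hpK.trans hn)
  · rw [← mul_div_assoc, rpow_neg_mul_rpow_sub_one (by positivity), one_div]

end Harmonic

theorem harmonic_of_stepSize_one
    (hu : DampedRecursion u₀ (fun j => stepSize α K 1 j * γ / 2)
      (fun j => stepSize α K 1 j ^ 2 * D) u) :
    DampedRecursion u₀ (fun k => α * γ / 2 / (k + K)) (fun k => α ^ 2 * D / (k + K) ^ 2) u := by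
  convert hu using 2 with k k
  · rw [stepSize, Real.rpow_one]
    ring
  · rw [stepSize, Real.rpow_one, div_pow]
    ring

end DampedRecursion

section HarmonicSteps

variable {K D α γ : ℝ}

theorem isRecursionBound_stepSize_one_of_lt (hK : 1 ≤ K) (hα : 0 ≤ α) (hγ : 0 < γ) (hD : 0 ≤ D)
    (hαγ : α < 2 / γ) (k : ℕ) :
    IsRecursionBound (stepSize α K 1) γ D k ((K / (k + K)) ^ (α * γ / 2))
      (8 * α ^ 2 / (2 - α * γ) * (1 / ((k : ℝ) + K) ^ (α * γ / 2)) * D) := by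
  rw [lt_div_iff₀ hγ] at hαγ
  have : 0 < 2 - α * γ := sub_pos.2 hαγ
  refine ⟨by positivity, fun u₀ u hu => ?_⟩
  refine (hu.harmonic_of_stepSize_one.le_of_harmonic_of_lt_one hK
    (by positivity) (by linarith) (by positivity) k).trans_eq ?_
  rw [show 1 - α * γ / 2 = (2 - α * γ) / 2 by ring]
  field_simp
  ring

theorem isRecursionBound_stepSize_one_of_eq (hK : 1 ≤ K) (hγ : 0 < γ) (hD : 0 ≤ D)
    (hαγ : α = 2 / γ) (k : ℕ) :
    IsRecursionBound (stepSize α K 1) γ D k ((K / (k + K)) ^ (α * γ / 2))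
      (4 * α ^ 2 * Real.log (k + K) / (k + K) * D) := by
  rw [eq_div_iff hγ.ne'] at hαγ
  have hlog : 0 ≤ Real.log (k + K) :=
    Real.log_nonneg (hK.trans (le_add_of_nonneg_left k.cast_nonneg))
  refine ⟨by positivity, fun u₀ u hu => ?_⟩
  refine (hu.harmonic_of_stepSize_one.le_of_harmonic_of_eq_one hK
    (by linarith) (by positivity) k).trans_eq ?_
  ring

theorem isRecursionBound_stepSize_one_of_gt (hK : 1 ≤ K) (hγ : 0 < γ) (hD : 0 ≤ D)
    (hαγ : 2 / γ < α) (k : ℕ) :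
    IsRecursionBound (stepSize α K 1) γ D k ((K / (k + K)) ^ (α * γ / 2))
      (8 * Real.exp 1 * α ^ 2 / (α * γ - 2) * (1 / (k + K)) * D) := by
  rw [div_lt_iff₀ hγ] at hαγ
  have : 0 < α * γ - 2 := sub_pos.2 hαγ
  have hconst : 4 * (α ^ 2 * D) * (1 / (k + K) / (α * γ / 2 - 1))
      = 8 * 1 * α ^ 2 / (α * γ - 2) * (1 / (k + K)) * D := by
    rw [show α * γ / 2 - 1 = (α * γ - 2) / 2 by ring]
    field_simp
    ring
  refine ⟨by positivity, fun u₀ u hu => ?_⟩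
  refine (hu.harmonic_of_stepSize_one.le_of_harmonic_of_one_lt hK
    (by linarith) (by positivity) k).trans ?_
  rw [hconst]
  gcongr
  exact Real.one_le_exp zero_le_one

end HarmonicSteps

theorem isRecursionBound_stepSize_zero {K D α γ : ℝ} (hα : 0 < α) (hγ : 0 < γ) (hD : 0 ≤ D)
    (k : ℕ) :
    IsRecursionBound (stepSize α K 0) γ D k ((1 - α * γ / 2) ^ k) (2 * α / γ * D) := by
  refine ⟨by positivity, fun u₀ u hu => ?_⟩
  simp only [stepSize_zero] at hu
  refine (hu.le_of_const (by positivity) (by positivity) k).trans_eq ?_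
  field_simp

section PolynomialSteps

variable {n α γ ξ : ℝ}

theorem one_sub_div_rpow_le_exp (hn : 0 < n) (hα : 0 ≤ α) (hγ : 0 ≤ γ) (hξ : 0 ≤ ξ)
    (hξ₁ : ξ < 1) :
    1 - α / n ^ ξ * γ / 2
      ≤ Real.exp (-(α * γ / (2 * (1 - ξ))) * ((n + 1) ^ (1 - ξ) - n ^ (1 - ξ))) := by
  have hs : 0 < 1 - ξ := sub_pos.2 hξ₁
  have hincrement := add_one_rpow_sub_rpow_le hn hs.le (sub_le_self 1 hξ)
  rw [sub_sub_cancel_left, Real.rpow_neg hn.le] at hincrement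
  refine le_trans ?_ (Real.add_one_le_exp _)
  rw [neg_mul, neg_add_eq_sub]
  refine sub_le_sub_left ?_ 1
  calc _ ≤ α * γ / (2 * (1 - ξ)) * ((1 - ξ) * (n ^ ξ)⁻¹) := by gcongr
    _ = α / n ^ ξ * γ / 2 := by field_simp

theorem four_div_mul_sub_le_sq (hn : 0 < n) (hα : 0 < α) (hγ : 0 < γ) (hξ : 0 ≤ ξ)
    (hle : 4 * ξ / (α * γ) ≤ n ^ (1 - ξ)) :
    4 / γ * (α / n ^ ξ - α / (n + 1) ^ ξ) ≤ (α / n ^ ξ) ^ 2 := by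
  have hratio := one_sub_div_le_div_add_one_rpow hn hξ
  rw [Real.div_rpow hn.le (by positivity)] at hratio
  have hnξ : 0 < n ^ ξ := by positivity
  rw [Real.rpow_sub hn, Real.rpow_one, div_le_div_iff₀ (by positivity) hnξ] at hle
  calc 4 / γ * (α / n ^ ξ - α / (n + 1) ^ ξ)
      = 4 / γ * (α / n ^ ξ) * (1 - n ^ ξ / (n + 1) ^ ξ) := by field_simp
    _ ≤ 4 / γ * (α / n ^ ξ) * (ξ / n) := by
        gcongr
        linarith
    _ = 4 * ξ * n ^ ξ * (α / (γ * n * (n ^ ξ) ^ 2)) := by field_simp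
    _ ≤ n * (α * γ) * (α / (γ * n * (n ^ ξ) ^ 2)) := by gcongr
    _ = (α / n ^ ξ) ^ 2 := by field_simp

theorem isRecursionBound_stepSize {K D : ℝ} (hK : 0 < K) (hα : 0 < α) (hγ : 0 < γ) (hξ : 0 ≤ ξ)
    (hξ₁ : ξ < 1) (hD : 0 ≤ D) (hKξ : (4 * ξ / (α * γ)) ^ (1 / (1 - ξ)) ≤ K) (k : ℕ) :
    IsRecursionBound (stepSize α K ξ) γ D k
      (Real.exp (-(α * γ / (2 * (1 - ξ))) * (((k : ℝ) + K) ^ (1 - ξ) - K ^ (1 - ξ))))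
      (4 / γ * stepSize α K ξ k * D) := by
  have hs : 0 < 1 - ξ := sub_pos.2 hξ₁
  rw [one_div, Real.rpow_inv_le_iff_of_pos (by positivity) hK.le hs] at hKξ
  set θ := α * γ / (2 * (1 - ξ))
  have hnonneg : ∀ j, 0 ≤ 4 / γ * stepSize α K ξ j * D := fun j => by
    have := stepSize_nonneg (ξ := ξ) hα.le hK.le j
    positivity
  refine ⟨hnonneg k, fun u₀ u hu => ?_⟩
  refine hu.le_supersolution (b := fun k : ℕ => u₀ * Real.exp (-θ * (((k : ℝ) + K) ^ (1 - ξ)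
    - K ^ (1 - ξ))) + 4 / γ * stepSize α K ξ k * D) ?_ (fun k => ?_) k
  · simpa using hnonneg 0
  · have hKn : K ≤ k + K := le_add_of_nonneg_left k.cast_nonneg
    simp only [stepSize, Nat.cast_succ, add_right_comm (k : ℝ) 1 K]
    set n : ℝ := k + K
    have hn : 0 < n := hK.trans_le hKn
    have hforcing := four_div_mul_sub_le_sq hn hα hγ hξ
      (hKξ.trans (Real.rpow_le_rpow hK.le hKn hs.le))
    have hexp : (1 - α / n ^ ξ * γ / 2) * Real.exp (-θ * (n ^ (1 - ξ) - K ^ (1 - ξ)))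
        ≤ Real.exp (-θ * ((n + 1) ^ (1 - ξ) - K ^ (1 - ξ))) := by
      calc _ ≤ Real.exp (-θ * ((n + 1) ^ (1 - ξ) - n ^ (1 - ξ)))
            * Real.exp (-θ * (n ^ (1 - ξ) - K ^ (1 - ξ))) := by
            gcongr
            exact one_sub_div_rpow_le_exp hn hα.le hγ.le hξ hξ₁
        _ = Real.exp (-θ * ((n + 1) ^ (1 - ξ) - K ^ (1 - ξ))) := by
            rw [← Real.exp_add, ← mul_add, sub_add_sub_cancel]
    have hdamp : (1 - α / n ^ ξ * γ / 2) * (4 / γ * (α / n ^ ξ) * D) + (α / n ^ ξ) ^ 2 * D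
        = (4 / γ * (α / n ^ ξ) - (α / n ^ ξ) ^ 2) * D := by
      field_simp
      ring
    have hscale := mul_le_mul_of_nonneg_left hexp hu.initial_nonneg
    have hscaleD := mul_le_mul_of_nonneg_right hforcing hD
    linarith

end PolynomialSteps

end LinearRecursion

section Iterates

variable {Ω : Type*} {mΩ : MeasurableSpace Ω} {P : Measure Ω} {d : ℕ}
  {F : EuclideanSpace ℝ (Fin d) → EuclideanSpace ℝ (Fin d)} {V R : EuclideanSpace ℝ (Fin d) → ℝ}
  {xs : EuclideanSpace ℝ (Fin d)} {x w : ℕ → Ω → EuclideanSpace ℝ (Fin d)} {β : ℕ → ℝ}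
  {A B C a G C₁ C₂ γ μ c₁ c₂ : ℝ}

theorem stronglyMeasurable_history (x w : ℕ → Ω → EuclideanSpace ℝ (Fin d)) (k : ℕ) :
    StronglyMeasurable[history x w k] (x k) := by
  refine ((comap_measurable (x k)).mono ?_ le_rfl).stronglyMeasurable
  exact le_sup_of_le_left
    (le_iSup₂_of_le (f := fun i (_ : i ∈ Iic k) => MeasurableSpace.comap (x i) inferInstance)
      k self_mem_Iic le_rfl)

theorem history_le (hx : ∀ k, Measurable (x k)) (hw : ∀ k, Measurable (w k)) (k : ℕ) :
    history x w k ≤ mΩ :=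
  sup_le (iSup₂_le fun i _ => (hx i).comap_le) (iSup₂_le fun i _ => (hw i).comap_le)

/-- `x` is the stochastic approximation process driven by `F` with steps `β k` and noise `w`. Given
the history, the square integrable noise `w k` is centered with variance at most
`A + B ‖x k‖ ^ 2`. -/
structure IsStochasticApproximation
    (F : EuclideanSpace ℝ (Fin d) → EuclideanSpace ℝ (Fin d)) (β : ℕ → ℝ) (A B : ℝ)
    (x w : ℕ → Ω → EuclideanSpace ℝ (Fin d)) (P : Measure Ω) : Prop where
  measurable_zero : Measurable (x 0)
  memLp_zero : MemLp (x 0) 2 P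
  measurable_noise : ∀ k, Measurable (w k)
  memLp_noise : ∀ k, MemLp (w k) 2 P
  step : ∀ k ω, x (k + 1) ω = x k ω + β k • (F (x k ω) + w k ω)
  condExp_noise : ∀ k, P[w k | history x w k] =ᵐ[P] 0
  condExp_norm_noise_sq_le : ∀ k,
    P[fun ω => ‖w k ω‖ ^ 2 | history x w k] ≤ᵐ[P] fun ω => A + B * ‖x k ω‖ ^ 2

namespace IsStochasticApproximation

variable (hx : IsStochasticApproximation F β A B x w P)
include hx

theorem measurable (hF : Continuous F) (k : ℕ) : Measurable (x k) := by
  induction k with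
  | zero => exact hx.measurable_zero
  | succ k ih =>
    rw [funext (hx.step k)]
    exact ih.add (((hF.measurable.comp ih).add (hx.measurable_noise k)).const_smul (β k))

theorem memLp [IsFiniteMeasure P] (hF : Continuous F) (hFle : ∀ z, ‖F z‖ ≤ C * ‖z - xs‖) (k : ℕ) :
    MemLp (x k) 2 P := by
  induction k with
  | zero => exact hx.memLp_zero
  | succ k ih =>
    rw [funext (hx.step k)]
    exact ih.add (((memLp_comp_of_norm_le hF hFle ih).add (hx.memLp_noise k)).const_smul (β k))

theorem integrable_norm_sub_sq [IsFiniteMeasure P] (hF : Continuous F)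
    (hFle : ∀ z, ‖F z‖ ≤ C * ‖z - xs‖) (k : ℕ) : Integrable (fun ω => ‖x k ω - xs‖ ^ 2) P :=
  ((hx.memLp hF hFle k).sub (memLp_const xs)).integrable_norm_pow two_ne_zero

variable [IsProbabilityMeasure P]

theorem dampedRecursion (hdrift : HasProximalDrift F R μ γ) (hF : Continuous F)
    (hFle : ∀ z, ‖F z‖ ≤ C * ‖z - xs‖) (hRc : Continuous R) (hc₁ : 0 < c₁)
    (hR₁ : ∀ z, c₁ * ‖z - xs‖ ^ 2 ≤ R z) (hR₂ : ∀ z, R z ≤ c₂ * ‖z - xs‖ ^ 2) (hμ : 0 < μ)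
    (hγ : 0 < γ) (hA : 0 ≤ A) (hB : 0 ≤ B) (hβ : ∀ k, 0 ≤ β k)
    (hβle : ∀ k, β k * (2 * (C ^ 2 + 2 * B) * (1 / c₁ + 2 * μ)) ≤ γ * μ)
    {z : EuclideanSpace ℝ (Fin d)} (hz : z ≠ xs) :
    DampedRecursion (c₂ * ∫ ω, ‖x 0 ω - xs‖ ^ 2 ∂P) (fun k => β k * γ / 2)
      (fun k => β k ^ 2 * ((A + 2 * B * ‖xs‖ ^ 2) / μ))
      (fun k => ∫ ω, moreauEnvelope R μ (x k ω) ∂P) where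
  nonneg_zero := integral_nonneg fun ω =>
    moreauEnvelope_nonneg (fun z => le_trans (by positivity) (hR₁ z)) hμ _
  le_initial := by
    have hR : ∀ z, 0 ≤ R z := fun z => le_trans (by positivity) (hR₁ z)
    rw [← integral_const_mul]
    exact integral_mono (integrable_moreauEnvelope_comp hR hRc hR₂ hμ hx.memLp_zero)
      ((hx.integrable_norm_sub_sq hF hFle 0).const_mul c₂)
      fun ω => (moreauEnvelope_le_self hR hμ _).trans (hR₂ _)
  rate_le_one k := by
    have hR : ∀ z, 0 ≤ R z := fun z => le_trans (by positivity) (hR₁ z)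
    have hdrift_le : γ * μ * γ ≤ 2 * C ^ 2 * (1 / c₁ + 2 * μ) :=
      (le_of_eq (by ring)).trans (hdrift.sq_mul_le hR hRc hμ hγ.le hc₁ hR₁ hz (hFle z))
    have hrate : β k * γ * (γ * μ) ≤ 1 * (γ * μ) :=
      calc β k * γ * (γ * μ) = β k * (γ * μ * γ) := by ring
        _ ≤ β k * (2 * C ^ 2 * (1 / c₁ + 2 * μ)) := mul_le_mul_of_nonneg_left hdrift_le (hβ k)
        _ ≤ β k * (2 * (C ^ 2 + 2 * B) * (1 / c₁ + 2 * μ)) := by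
          have := hβ k
          gcongr
          linarith
        _ ≤ 1 * (γ * μ) := (hβle k).trans_eq (one_mul _).symm
    linarith [le_of_mul_le_mul_right hrate (mul_pos hγ hμ)]
  step_le k := by
    simp only [hx.step]
    exact hdrift.integral_moreauEnvelope_step_le
      (history_le (hx.measurable hF) hx.measurable_noise k) hF hFle hRc hc₁ hR₁ hR₂ hμ hγ.le hA hB
      (hβ k) (hβle k) (stronglyMeasurable_history x w k) (hx.memLp hF hFle k) (hx.memLp_noise k)
      (hx.condExp_noise k) (hx.condExp_norm_noise_sq_le k)

theorem integral_sq_norm_sub_le (hdrift : HasProximalDrift F R μ γ) (hF : Continuous F)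
    (hFle : ∀ z, ‖F z‖ ≤ C * ‖z - xs‖) (hRc : Continuous R) (hc₁ : 0 < c₁)
    (hR₁ : ∀ z, c₁ * ‖z - xs‖ ^ 2 ≤ R z) (hR₂ : ∀ z, R z ≤ c₂ * ‖z - xs‖ ^ 2) (hμ : 0 < μ)
    (hγ : 0 < γ) (hA : 0 ≤ A) (hB : 0 ≤ B) (hβ : ∀ k, 0 ≤ β k)
    (hβle : ∀ k, β k * (2 * (C ^ 2 + 2 * B) * (1 / c₁ + 2 * μ)) ≤ γ * μ) {k : ℕ} {Z S : ℝ}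
    (hbound : IsRecursionBound β γ ((A + 2 * B * ‖xs‖ ^ 2) / μ) k Z S) :
    ∫ ω, ‖x k ω - xs‖ ^ 2 ∂P
      ≤ c₂ * (1 / c₁ + 2 * μ) * (∫ ω, ‖x 0 ω - xs‖ ^ 2 ∂P) * Z + (1 / c₁ + 2 * μ) * S := by
  have hc : 0 < 1 / c₁ + 2 * μ := by positivity
  by_cases htrivial : ∀ z, z = xs
  · simpa [fun j ω => htrivial (x j ω)] using mul_nonneg hc.le hbound.nonneg
  obtain ⟨z, hz⟩ := not_forall.1 htrivial
  calc ∫ ω, ‖x k ω - xs‖ ^ 2 ∂P ≤ (1 / c₁ + 2 * μ) * ∫ ω, moreauEnvelope R μ (x k ω) ∂P :=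
        integral_sq_norm_sub_le_mul_integral_moreauEnvelope hRc hc₁ hR₁ hR₂ hμ (hx.memLp hF hFle k)
    _ ≤ (1 / c₁ + 2 * μ) * (c₂ * (∫ ω, ‖x 0 ω - xs‖ ^ 2 ∂P) * Z + S) := by
        gcongr
        exact hbound.le _ _
          (hx.dampedRecursion hdrift hF hFle hRc hc₁ hR₁ hR₂ hμ hγ hA hB hβ hβle hz)
    _ = c₂ * (1 / c₁ + 2 * μ) * (∫ ω, ‖x 0 ω - xs‖ ^ 2 ∂P) * Z + (1 / c₁ + 2 * μ) * S := by ring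

end IsStochasticApproximation

theorem envelopeConst_pos (hC₁ : 0 < C₁) (hμ : 0 < μ) : 0 < envelopeConst a C₁ μ := by
  unfold envelopeConst
  positivity

theorem maxStep_pos (hC : 0 < C) (hC₁ : 0 < C₁) (hB : 0 ≤ B) (hμ : 0 < μ)
    (hγM : 0 < driftConst a γ C G C₁ C₂ μ) : 0 < maxStep a γ C G C₁ C₂ B μ := by
  have := envelopeConst_pos (a := a) hC₁ hμ
  unfold maxStep
  positivity

theorem IsLyapunovFunction.integral_sq_norm_sub_le [IsProbabilityMeasure P]
    (hV : IsLyapunovFunction F xs V a γ G C₁ C₂) (hFxs : F xs = 0) (hC : 0 < C)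
    (hF : ∀ y z, ‖F y - F z‖ ≤ C * ‖y - z‖) (hμ : 0 < μ) (hγM : 0 < driftConst a γ C G C₁ C₂ μ)
    (hx : IsStochasticApproximation F β A B x w P) (hA : 0 ≤ A) (hB : 0 ≤ B) (hβ : ∀ k, 0 ≤ β k)
    (hβle : ∀ k, β k ≤ maxStep a γ C G C₁ C₂ B μ) {k : ℕ} {Z S : ℝ}
    (hbound : IsRecursionBound β (driftConst a γ C G C₁ C₂ μ) ((A + 2 * B * ‖xs‖ ^ 2) / μ) k Z S) :
    ∫ ω, ‖x k ω - xs‖ ^ 2 ∂P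
      ≤ C₂ ^ (2 / a) * envelopeConst a C₁ μ * (∫ ω, ‖x 0 ω - xs‖ ^ 2 ∂P) * Z
        + envelopeConst a C₁ μ * S := by
  have hc₁ : 0 < C₁ ^ (2 / a) := Real.rpow_pos_of_pos hV.lower_pos _
  have hden : 0 < 2 * (C ^ 2 + 2 * B) * envelopeConst a C₁ μ :=
    mul_pos (by positivity) (envelopeConst_pos hV.lower_pos hμ)
  refine hx.integral_sq_norm_sub_le (hV.hasProximalDrift hC.le hF hμ hγM.le) ?_ ?_ ?_ hc₁
    hV.mul_sq_le_rpow hV.rpow_le_mul_sq hμ hγM hA hB hβ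
    (fun k => (le_div_iff₀ hden).1 (hβle k)) hbound
  · exact continuous_of_norm_sub_le hF
  · exact fun z => by simpa [hFxs] using hF z xs
  · exact hV.continuous_rpow

end Iterates

theorem mainTheorem1 {d : ℕ}
    -- the closed loop drift, its equilibrium and the Lyapunov function
    (F : EuclideanSpace ℝ (Fin d) → EuclideanSpace ℝ (Fin d))
    (xs : EuclideanSpace ℝ (Fin d))
    (V : EuclideanSpace ℝ (Fin d) → ℝ)
    (a γ C G C₁ C₂ : ℝ)
    (ha : 0 < a) (hγ : 0 < γ) (hC : 0 < C) (hG : 0 < G) (hC₁ : 0 < C₁) (hC₂ : 0 < C₂)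
    (hFxs : F xs = 0)
    (hF : ∀ x y, ‖F x - F y‖ ≤ C * ‖x - y‖)
    (hV : LocallyLipschitz V)
    (hdrift : ∀ x, ∀ g ∈ clarkeGradient V x, inner ℝ g (F x) ≤ -γ * V x)
    (hgrowth : ∀ x, C₁ * ‖x - xs‖ ^ a ≤ V x ∧ V x ≤ C₂ * ‖x - xs‖ ^ a)
    (hgrad : ∀ x, ∀ g ∈ clarkeGradient V x, ‖g‖ ≤ G * ‖x - xs‖ ^ (a - 1))
    -- the stochastic approximation iterates and the noise
    {Ω : Type*} [MeasurableSpace Ω] (P : Measure Ω) [IsProbabilityMeasure P]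
    (x w : ℕ → Ω → EuclideanSpace ℝ (Fin d))
    (A B α ξ K : ℝ)
    (hA : 0 ≤ A) (hB : 0 ≤ B) (hα : 0 < α) (hK : 1 ≤ K)
    (hx0 : Measurable (x 0)) (hx0L2 : MemLp (x 0) 2 P)
    (hw : ∀ k, Measurable (w k)) (hwL2 : ∀ k, MemLp (w k) 2 P)
    (hstep : ∀ k ω, x (k + 1) ω = x k ω + (α / ((k : ℝ) + K) ^ ξ) • (F (x k ω) + w k ω))
    (hmean : ∀ k, P[w k | history x w k] =ᵐ[P] 0)
    (hvar : ∀ k, P[fun ω => ‖w k ω‖ ^ 2 | history x w k]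
      ≤ᵐ[P] fun ω => A + B * ‖x k ω‖ ^ 2) :
    -- `γ_M` is positive for all small `μ`
    (∃ μ₀ : ℝ, 0 < μ₀ ∧ ∀ μ : ℝ, 0 < μ → μ < μ₀ →
      0 < driftConst a γ C G C₁ C₂ μ ∧
        driftConst a γ C G C₁ C₂ μ < 2 * γ / a * (C₁ / C₂) ^ (2 / a)) ∧
    ∀ μ γM c D : ℝ, 0 < μ → γM = driftConst a γ C G C₁ C₂ μ → 0 < γM →
      c = envelopeConst a C₁ μ → D = (A + 2 * B * ‖xs‖ ^ 2) / μ →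
      -- `γ_M` is a drift constant of the Moreau envelope of `V ^ (2 / a)`
      (∀ y, ∀ g ∈ clarkeGradient (moreauEnvelope (fun z => V z ^ (2 / a)) μ) y,
        inner ℝ g (F y) ≤ -γM * moreauEnvelope (fun z => V z ^ (2 / a)) μ y) ∧
      -- the mean square bounds
      ∀ k : ℕ, Integrable (fun ω => ‖x k ω - xs‖ ^ 2) P ∧
        (ξ = 1 → α / maxStep a γ C G C₁ C₂ B μ ≤ K →
          (α < 2 / γM →
            ∫ ω, ‖x k ω - xs‖ ^ 2 ∂P ≤
              C₂ ^ (2 / a) * c * (∫ ω, ‖x 0 ω - xs‖ ^ 2 ∂P) * (K / (k + K)) ^ (α * γM / 2)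
              + c * (8 * α ^ 2 / (2 - α * γM) * (1 / ((k : ℝ) + K) ^ (α * γM / 2)) * D)) ∧
          (α = 2 / γM →
            ∫ ω, ‖x k ω - xs‖ ^ 2 ∂P ≤
              C₂ ^ (2 / a) * c * (∫ ω, ‖x 0 ω - xs‖ ^ 2 ∂P) * (K / (k + K)) ^ (α * γM / 2)
              + c * (4 * α ^ 2 * Real.log (k + K) / (k + K) * D)) ∧
          (2 / γM < α →
            ∫ ω, ‖x k ω - xs‖ ^ 2 ∂P ≤
              C₂ ^ (2 / a) * c * (∫ ω, ‖x 0 ω - xs‖ ^ 2 ∂P) * (K / (k + K)) ^ (α * γM / 2)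
              + c * (8 * Real.exp 1 * α ^ 2 / (α * γM - 2) * (1 / (k + K)) * D))) ∧
        (0 < ξ → ξ < 1 → (α / maxStep a γ C G C₁ C₂ B μ) ^ (1 / ξ) ≤ K →
          (4 * ξ / (α * γM)) ^ (1 / (1 - ξ)) ≤ K →
            ∫ ω, ‖x k ω - xs‖ ^ 2 ∂P ≤
              C₂ ^ (2 / a) * c * (∫ ω, ‖x 0 ω - xs‖ ^ 2 ∂P)
                * Real.exp (-(α * γM / (2 * (1 - ξ)))
                    * (((k : ℝ) + K) ^ (1 - ξ) - K ^ (1 - ξ)))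
              + 4 * α * c / (γM * ((k : ℝ) + K) ^ ξ) * D) ∧
        (ξ = 0 → α ≤ maxStep a γ C G C₁ C₂ B μ →
            ∫ ω, ‖x k ω - xs‖ ^ 2 ∂P ≤
              C₂ ^ (2 / a) * c * (∫ ω, ‖x 0 ω - xs‖ ^ 2 ∂P) * (1 - α * γM / 2) ^ k
              + c * (2 * α / γM * D)) := by
  have hLyap : IsLyapunovFunction F xs V a γ G C₁ C₂ :=
    ⟨ha, hγ, hG, hC₁, hC₂, hV, hdrift, hgrowth, hgrad⟩
  have hx : IsStochasticApproximation F (stepSize α K ξ) A B x w P :=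
    ⟨hx0, hx0L2, hw, hwL2, hstep, hmean, hvar⟩
  have hK₀ : 0 < K := one_pos.trans_le hK
  obtain ⟨μ₀, hμ₀, hpos⟩ := exists_forall_driftConst_pos (C := C) (G := G) ha hγ hC₁ hC₂
  refine ⟨⟨μ₀, hμ₀, fun μ hμ hlt => ⟨hpos μ hμ hlt, driftConst_lt ha hγ hC hG hC₁ hC₂ hμ⟩⟩, ?_⟩
  rintro μ _ _ _ hμ rfl hγM rfl rfl
  have hD : 0 ≤ (A + 2 * B * ‖xs‖ ^ 2) / μ := by positivity
  have hm : 0 < maxStep a γ C G C₁ C₂ B μ := maxStep_pos hC hC₁ hB hμ hγM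
  have hmean_sq := hLyap.integral_sq_norm_sub_le hFxs hC hF hμ hγM hx hA hB
    (stepSize_nonneg hα.le hK₀.le)
  refine ⟨fun y g hg => hLyap.inner_le_of_mem_clarkeGradient_moreauEnvelope hC.le hF hμ hγM.le hg,
    fun k => ⟨hx.integrable_norm_sub_sq (continuous_of_norm_sub_le hF)
      (fun z => by simpa [hFxs] using hF z xs) k, ?_, ?_, ?_⟩⟩
  · rintro rfl hKm
    have hβ := stepSize_le hα.le hK₀ one_pos hm (by simpa using hKm)
    exact ⟨fun hlt => hmean_sq hβ (isRecursionBound_stepSize_one_of_lt hK hα.le hγM hD hlt k),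
      fun heq => hmean_sq hβ (isRecursionBound_stepSize_one_of_eq hK hγM hD heq k),
      fun hgt => hmean_sq hβ (isRecursionBound_stepSize_one_of_gt hK hγM hD hgt k)⟩
  · intro hξ hξ₁ hKm hKξ
    refine (hmean_sq (stepSize_le hα.le hK₀ hξ hm hKm)
      (isRecursionBound_stepSize hK₀ hα hγM hξ.le hξ₁ hD hKξ k)).trans_eq ?_
    rw [stepSize]
    ring
  · rintro rfl hαm
    exact hmean_sq (fun k => (stepSize_zero α K k).trans_le hαm)
      (isRecursionBound_stepSize_zero hα hγM hD k)
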